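/- Let $\mu>0$, $\lambda\in\mathbb{R}$ with $2\mu+\lambda>0$, and $\gamma>1$. Consider the Cauchy problem for the one-dimensional full compressible Navier–Stokes system with zero heat conduction, $$\rho_t+(\rho u)_x=0,\qquad (\rho u)_t+(\rho u^2)_x+p_x=(2\mu+\lambda)u_{xx},\qquad (\rho e)_t+(\rho e u)_x+p\,u_x=(2\mu+\lambda)u_x^2,$$ for $x\in\mathbb{R}$, $0<t<T$, where $p=(\gamma-1)\rho e$, with initial data $(\rho,u,e)(x,0)=(\rho_0,u_0,e_0)(x)$, $x\in\mathbb{R}$. Let $\rho_0,u_0,e_0:\mathbb{R}\to\mathbb{R}$ be continuous, with $\operatorname{supp}\rho_0=[0,1]$ and $\rho_0>0$ on $(0,1)$, and with $e_0\ge 0$ on $(0,1)$ and $e_0\not\equiv0$ on $(0,1)$. Suppose that one of the following two conditions holds. (a) There are $\lambda_5>0$ and $0<\lambda_7<1$ such that $\rho_0,e_0$ are differentiable on $(0,\lambda_7)$ and $$\frac{(\rho_0)_x}{\rho_0}+\frac{(e_0)_x}{\rho_0}\ge\lambda_5\ \text{ on }(0,\lambda_7),\qquad u_0(\lambda_7)<0,\qquad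 u_0\le 0\ \text{ on }(0,\lambda_7).$$ (b) There are $\lambda_6>0$ and $0<\lambda_8<1$ such that $\rho_0,e_0$ are differentiable on $(\lambda_8,1)$ and $$\frac{(\rho_0)_x}{\rho_0}+\frac{(e_0)_x}{\rho_0}\le-\lambda_6\ \text{ on }(\lambda_8,1),\qquad u_0(\lambda_8)>0,\qquad u_0\ge 0\ \text{ on }(\lambda_8,1).$$ Then for every real $m>2$ and every $T>0$ the Cauchy problem has no solution $(\rho,u,e)$ with $\rho,u,e\in C^1([0,T];H^m(\mathbb{R}))$. Here $H^m(\mathbb{R})$ is the inhomogeneous $L^2$-based Sobolev space, functions in it are identified with their continuous representatives, and the equations are understood for every $t\in(0,T)$ and almost every $x\in\mathbb{R}$. -/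

import Mathlib

open MeasureTheory Set
open scoped SchwartzMap

namespace FullNS

/-- `f : ℝ → ℝ` is the continuous representative of an element of the Sobolev space `H^m(ℝ)`
(`m > 1/2`), and `g ∈ L²(ℝ)` is its Bessel potential `(1 + |ξ|²)^{m/2}(D) f`. Thus `f ∈ H^m(ℝ)` and
`‖f‖_{H^m} = ‖g‖_{L²}`. -/
def HasBesselLift (m : ℝ) (f : ℝ → ℝ) (g : Lp ℂ 2 (volume : Measure ℝ)) : Prop :=
  Continuous f ∧
    ∃ hf : MemLp (fun x : ℝ => (f x : ℂ)) 2 (volume : Measure ℝ),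
      TemperedDistribution.besselPotential ℝ ℂ m ((hf.toLp _ : Lp ℂ 2 (volume : Measure ℝ)) : 𝓢'(ℝ, ℂ))
        = (g : 𝓢'(ℝ, ℂ))

/-- `f ∈ C¹([0,T]; H^m(ℝ))`, where `f t` is the function of `x` at time `t`. As the Bessel potential
of order `m` is an isometry of `H^m(ℝ)` onto `L²(ℝ)`, this says that `t ↦ f t` is a `C¹` curve for
the norm of `H^m(ℝ)`. -/
def IsC1Sobolev (m T : ℝ) (f : ℝ → ℝ → ℝ) : Prop :=
  ∃ g : ℝ → Lp ℂ 2 (volume : Measure ℝ),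
    ContDiffOn ℝ 1 g (Icc 0 T) ∧ ∀ t ∈ Icc 0 T, HasBesselLift m (f t) (g t)

/-- The pressure of a polytropic gas, `p = (γ - 1) ρ e`. -/
def pressure (γ : ℝ) (ρ e : ℝ → ℝ → ℝ) (t x : ℝ) : ℝ := (γ - 1) * ρ t x * e t x

/-- `(ρ, u, e) ∈ C¹([0,T]; H^m(ℝ))` solves the Cauchy problem for the one-dimensional full
compressible Navier-Stokes system without heat conduction, with viscosity coefficients `μ`, `lam`,
adiabatic exponent `γ` and initial data `(ρ₀, u₀, e₀)`. The equations are required at every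
`t ∈ (0,T)` for almost every `x`. For `m > 2` every first derivative below is classical, while
`∂ₓ u` is locally absolutely continuous, so that `∂ₓ∂ₓ u` exists almost everywhere and is the weak
second derivative. -/
structure IsSolution (μ lam γ m T : ℝ) (ρ₀ u₀ e₀ : ℝ → ℝ) (ρ u e : ℝ → ℝ → ℝ) : Prop where
  regular_density : IsC1Sobolev m T ρ
  regular_velocity : IsC1Sobolev m T u
  regular_energy : IsC1Sobolev m T e
  mass : ∀ t ∈ Ioo 0 T, ∀ᵐ x : ℝ,
    deriv (fun s => ρ s x) t + deriv (fun y => ρ t y * u t y) x = 0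
  momentum : ∀ t ∈ Ioo 0 T, ∀ᵐ x : ℝ,
    deriv (fun s => ρ s x * u s x) t + deriv (fun y => ρ t y * u t y * u t y) x
        + deriv (fun y => pressure γ ρ e t y) x
      = μ * deriv (deriv (u t)) x + (μ + lam) * deriv (deriv (u t)) x
  energy : ∀ t ∈ Ioo 0 T, ∀ᵐ x : ℝ,
    deriv (fun s => ρ s x * e s x) t + deriv (fun y => ρ t y * e t y * u t y) x
        + pressure γ ρ e t x * deriv (u t) x
      = μ / 2 * (deriv (u t) x + deriv (u t) x) ^ 2 + lam * (deriv (u t) x) ^ 2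
  initial_density : ∀ x, ρ 0 x = ρ₀ x
  initial_velocity : ∀ x, u 0 x = u₀ x
  initial_energy : ∀ x, e 0 x = e₀ x

/-- The condition on the initial data near the left end point of `(0,1)`. -/
def LeftCondition (ρ₀ u₀ e₀ : ℝ → ℝ) : Prop :=
  ∃ l₅ l₇ : ℝ, 0 < l₅ ∧ 0 < l₇ ∧ l₇ < 1 ∧
    (∀ x ∈ Ioo 0 l₇, DifferentiableAt ℝ ρ₀ x ∧ DifferentiableAt ℝ e₀ x ∧
      l₅ ≤ deriv ρ₀ x / ρ₀ x + deriv e₀ x / ρ₀ x) ∧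
    u₀ l₇ < 0 ∧ ∀ x ∈ Ioo 0 l₇, u₀ x ≤ 0

/-- The condition on the initial data near the right end point of `(0,1)`. -/
def RightCondition (ρ₀ u₀ e₀ : ℝ → ℝ) : Prop :=
  ∃ l₆ l₈ : ℝ, 0 < l₆ ∧ 0 < l₈ ∧ l₈ < 1 ∧
    (∀ x ∈ Ioo l₈ 1, DifferentiableAt ℝ ρ₀ x ∧ DifferentiableAt ℝ e₀ x ∧
      deriv ρ₀ x / ρ₀ x + deriv e₀ x / ρ₀ x ≤ -l₆) ∧
    0 < u₀ l₈ ∧ ∀ x ∈ Ioo l₈ 1, 0 ≤ u₀ x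

end FullNS

/-!
Write `q = ρ e` and `ν = 2μ + λ`. A solution of class `C¹([0,T]; H^m)` is a pointwise solution with
continuous first derivatives. In the vacuum the energy equation forces `∂ₓ u = 0`, hence `u = 0`, so
the vacuum boundary does not move and `u = ∂ₓ u = 0` there. The momentum of `[a, x]` relative to an
exponential barrier obeys a maximum principle, which forces a nonzero velocity at the boundary if
the initial velocity points outwards; the pressure only enters through its sign.
-/

namespace FullNS

open Filter Topology

/-- The partial derivative in `x` of a function of `(t, x)`. -/
noncomputable def spaceDeriv (f : ℝ → ℝ → ℝ) (t x : ℝ) : ℝ := deriv (f t) x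

/-- The partial derivative in `t` of a function of `(t, x)`. -/
noncomputable def timeDeriv (f : ℝ → ℝ → ℝ) (t x : ℝ) : ℝ := deriv (fun s => f s x) t

local notation "∂ₓ" => spaceDeriv

local notation "∂ₜ" => timeDeriv

/-- A function of `(t, x)` of class `C¹` on the strip `0 < t < T`; it and its space derivative are
continuous for all times, so that they can be evaluated at `t = 0` and `t = T`. -/
structure IsC1Field (T : ℝ) (f : ℝ → ℝ → ℝ) : Prop where
  continuous : Continuous (Function.uncurry f)
  differentiable_space : ∀ t, Differentiable ℝ (f t)
  continuous_spaceDeriv : Continuous (Function.uncurry (∂ₓ f))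
  differentiableAt_time : ∀ t ∈ Ioo 0 T, ∀ x, DifferentiableAt ℝ (fun s => f s x) t
  continuousOn_timeDeriv : ContinuousOn (Function.uncurry (∂ₜ f)) (Ioo 0 T ×ˢ univ)

namespace IsC1Field

variable {T : ℝ} {f g : ℝ → ℝ → ℝ}

lemma hasDerivAt_space (hf : IsC1Field T f) (t x : ℝ) : HasDerivAt (f t) (∂ₓ f t x) x :=
  (hf.differentiable_space t x).hasDerivAt

lemma hasDerivAt_time (hf : IsC1Field T f) {t : ℝ} (ht : t ∈ Ioo 0 T) (x : ℝ) :
    HasDerivAt (fun s => f s x) (∂ₜ f t x) t :=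
  (hf.differentiableAt_time t ht x).hasDerivAt

lemma of_hasDerivAt {fx ft : ℝ → ℝ → ℝ} (hx : ∀ t x, HasDerivAt (f t) (fx t x) x)
    (ht : ∀ t ∈ Ioo 0 T, ∀ x, HasDerivAt (fun s => f s x) (ft t x) t)
    (hf : Continuous (Function.uncurry f)) (hfx : Continuous (Function.uncurry fx))
    (hft : ContinuousOn (Function.uncurry ft) (Ioo 0 T ×ˢ univ)) : IsC1Field T f where
  continuous := hf
  differentiable_space t x := (hx t x).differentiableAt
  continuous_spaceDeriv := by
    have : ∂ₓ f = fx := funext₂ fun t x => (hx t x).deriv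
    rwa [this]
  differentiableAt_time t htT x := (ht t htT x).differentiableAt
  continuousOn_timeDeriv := hft.congr fun p hp => (ht p.1 hp.1 p.2).deriv

lemma spaceDeriv_mul (hf : IsC1Field T f) (hg : IsC1Field T g) (t x : ℝ) :
    ∂ₓ (f * g) t x = ∂ₓ f t x * g t x + f t x * ∂ₓ g t x :=
  ((hf.hasDerivAt_space t x).mul (hg.hasDerivAt_space t x)).deriv

lemma timeDeriv_mul (hf : IsC1Field T f) (hg : IsC1Field T g) {t : ℝ} (ht : t ∈ Ioo 0 T)
    (x : ℝ) : ∂ₜ (f * g) t x = ∂ₜ f t x * g t x + f t x * ∂ₜ g t x :=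
  ((hf.hasDerivAt_time ht x).mul (hg.hasDerivAt_time ht x)).deriv

protected lemma mul (hf : IsC1Field T f) (hg : IsC1Field T g) : IsC1Field T (f * g) :=
  of_hasDerivAt (fun t x => (hf.hasDerivAt_space t x).mul (hg.hasDerivAt_space t x))
    (fun _ ht x => (hf.hasDerivAt_time ht x).mul (hg.hasDerivAt_time ht x))
    (hf.continuous.mul hg.continuous)
    ((hf.continuous_spaceDeriv.mul hg.continuous).add (hf.continuous.mul hg.continuous_spaceDeriv))
    ((hf.continuousOn_timeDeriv.mul hg.continuous.continuousOn).add
      (hf.continuous.continuousOn.mul hg.continuousOn_timeDeriv))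

lemma spaceDeriv_sub (hf : IsC1Field T f) (hg : IsC1Field T g) (t x : ℝ) :
    ∂ₓ (f - g) t x = ∂ₓ f t x - ∂ₓ g t x :=
  ((hf.hasDerivAt_space t x).sub (hg.hasDerivAt_space t x)).deriv

lemma timeDeriv_sub (hf : IsC1Field T f) (hg : IsC1Field T g) {t : ℝ} (ht : t ∈ Ioo 0 T)
    (x : ℝ) : ∂ₜ (f - g) t x = ∂ₜ f t x - ∂ₜ g t x :=
  ((hf.hasDerivAt_time ht x).sub (hg.hasDerivAt_time ht x)).deriv

protected lemma sub (hf : IsC1Field T f) (hg : IsC1Field T g) : IsC1Field T (f - g) :=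
  of_hasDerivAt (fun t x => (hf.hasDerivAt_space t x).sub (hg.hasDerivAt_space t x))
    (fun _ ht x => (hf.hasDerivAt_time ht x).sub (hg.hasDerivAt_time ht x))
    (hf.continuous.sub hg.continuous)
    (hf.continuous_spaceDeriv.sub hg.continuous_spaceDeriv)
    (hf.continuousOn_timeDeriv.sub hg.continuousOn_timeDeriv)

lemma continuous_slice (hf : IsC1Field T f) (t : ℝ) : Continuous (f t) :=
  (hf.differentiable_space t).continuous

lemma continuous_spaceDeriv_slice (hf : IsC1Field T f) (t : ℝ) : Continuous (∂ₓ f t) :=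
  hf.continuous_spaceDeriv.uncurry_left t

lemma continuous_timeDeriv_slice (hf : IsC1Field T f) {t : ℝ} (ht : t ∈ Ioo 0 T) :
    Continuous (∂ₜ f t) :=
  hf.continuousOn_timeDeriv.comp_continuous (continuous_const.prodMk continuous_id)
    fun _ => ⟨ht, mem_univ _⟩

lemma hasDerivAt_along (hf : IsC1Field T f) {X : ℝ → ℝ} {t v : ℝ} (ht : t ∈ Ioo 0 T)
    (hX : HasDerivAt X v t) :
    HasDerivAt (fun s => f s (X s)) (∂ₜ f t (X t) + ∂ₓ f t (X t) * v) t := by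
  have hnhds : Ioo 0 T ×ˢ univ ∈ 𝓝 (t, X t) :=
    prod_mem_nhds (Ioo_mem_nhds ht.1 ht.2) univ_mem
  have hspan := (ContinuousLinearMap.toSpanSingletonCLE (𝕜 := ℝ) (E := ℝ)).continuous
  have hfderiv : HasStrictFDerivAt (Function.uncurry f)
      ((ContinuousLinearMap.toSpanSingleton ℝ (∂ₜ f t (X t))).coprod
        (ContinuousLinearMap.toSpanSingleton ℝ (∂ₓ f t (X t)))) (t, X t) :=
    hasStrictFDerivAt_uncurry_coprod (u := (t, X t)) (f := f)
      (f₁ := fun t x => ContinuousLinearMap.toSpanSingleton ℝ (∂ₜ f t x))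
      (f₂ := fun t x => ContinuousLinearMap.toSpanSingleton ℝ (∂ₓ f t x))
      (mem_of_superset hnhds fun p hp => (hf.hasDerivAt_time hp.1 p.2).hasFDerivAt)
      (.of_forall fun p => (hf.hasDerivAt_space p.1 p.2).hasFDerivAt)
      (hspan.continuousAt.comp (hf.continuousOn_timeDeriv.continuousAt hnhds))
      (hspan.comp hf.continuous_spaceDeriv).continuousAt
  simpa [Function.comp_def, Function.uncurry, mul_comm] using
    hfderiv.hasFDerivAt.comp_hasDerivAt t ((hasDerivAt_id t).prodMk hX)

end IsC1Field

section Characteristics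

variable {T C : ℝ} {K : NNReal} {u : ℝ → ℝ → ℝ} {X Y : ℝ → ℝ}

lemma exists_isIntegralCurveOn (hu : Continuous (Function.uncurry u))
    (hlip : ∀ t, LipschitzWith K (u t)) (hC : ∀ t x, |u t x| ≤ C) {t₁ : ℝ} (ht₁ : t₁ ∈ Icc 0 T)
    (x₁ : ℝ) : ∃ X, X t₁ = x₁ ∧ IsIntegralCurveOn X u (Icc 0 T) := by
  have hC0 : 0 ≤ C := (abs_nonneg _).trans (hC 0 0)
  have hT : 0 ≤ T := ht₁.1.trans ht₁.2
  have hPL : IsPicardLindelof u (⟨t₁, ht₁⟩ : Icc 0 T) x₁ (C * T).toNNReal 0 C.toNNReal K := by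
    refine ⟨fun t _ => (hlip t).lipschitzOnWith, fun x _ => (hu.uncurry_right x).continuousOn,
      fun t _ x _ => (hC t x).trans (Real.le_coe_toNNReal C), ?_⟩
    rw [Real.coe_toNNReal _ hC0, Real.coe_toNNReal _ (by positivity), NNReal.coe_zero, sub_zero,
      sub_zero]
    exact mul_le_mul_of_nonneg_left (max_le (sub_le_self T ht₁.1) ht₁.2) hC0
  exact hPL.exists_eq_forall_mem_Icc_hasDerivWithinAt₀

lemma hasDerivAt_of_isIntegralCurveOn (hX : IsIntegralCurveOn X u (Icc 0 T)) {t : ℝ}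
    (ht : t ∈ Ioo 0 T) : HasDerivAt X (u t (X t)) t :=
  (hX t (Ioo_subset_Icc_self ht)).hasDerivAt (Icc_mem_nhds ht.1 ht.2)

lemma eq_of_isIntegralCurveOn (hlip : ∀ t, LipschitzWith K (u t))
    (hX : IsIntegralCurveOn X u (Icc 0 T)) (hY : IsIntegralCurveOn Y u (Icc 0 T)) {s t : ℝ}
    (hs : s ∈ Icc 0 T) (ht : t ∈ Icc 0 T) (h : X s = Y s) : X t = Y t := by
  rcases le_total s t with hst | hts
  · have hsub : Icc s t ⊆ Icc 0 T := Icc_subset_Icc hs.1 ht.2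
    have hderiv : ∀ {Z}, IsIntegralCurveOn Z u (Icc 0 T) →
        ∀ r ∈ Ico s t, HasDerivWithinAt Z (u r (Z r)) (Ici r) r := fun hZ r hr =>
      (hZ.mono hsub r (Ico_subset_Icc_self hr)).mono_of_mem_nhdsWithin (Icc_mem_nhdsGE_of_mem hr)
    exact ODE_solution_unique hlip (hX.continuousOn.mono hsub) (hderiv hX)
      (hY.continuousOn.mono hsub) (hderiv hY) h ⟨hst, le_rfl⟩
  · have hsub : Icc t s ⊆ Icc 0 T := Icc_subset_Icc ht.1 hs.2
    have hderiv : ∀ {Z}, IsIntegralCurveOn Z u (Icc 0 T) →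
        ∀ r ∈ Ioc t s, HasDerivWithinAt Z (u r (Z r)) (Iic r) r := fun hZ r hr =>
      (hZ.mono hsub r (Ioc_subset_Icc_self hr)).mono_of_mem_nhdsWithin (Icc_mem_nhdsLE_of_mem hr)
    exact ODE_solution_unique_of_mem_Icc_left (s := fun _ => univ)
      (fun r _ => (hlip r).lipschitzOnWith) (hX.continuousOn.mono hsub) (hderiv hX)
      (fun _ _ => trivial) (hY.continuousOn.mono hsub) (hderiv hY) (fun _ _ => trivial) h
      ⟨le_rfl, hts⟩

lemma le_of_isIntegralCurveOn (hlip : ∀ t, LipschitzWith K (u t))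
    (hX : IsIntegralCurveOn X u (Icc 0 T)) (hY : IsIntegralCurveOn Y u (Icc 0 T)) {s t : ℝ}
    (hs : s ∈ Icc 0 T) (ht : t ∈ Icc 0 T) (h : X s ≤ Y s) : X t ≤ Y t := by
  by_contra! hlt
  have hsub : uIcc s t ⊆ Icc 0 T := uIcc_subset_Icc hs ht
  obtain ⟨r, hr, hXY⟩ : (0 : ℝ) ∈ (X - Y) '' uIcc s t :=
    intermediate_value_uIcc ((hX.continuousOn.sub hY.continuousOn).mono hsub)
      (Icc_subset_uIcc ⟨sub_nonpos.2 h, (sub_pos.2 hlt).le⟩)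
  exact hlt.ne' (eq_of_isIntegralCurveOn hlip hX hY (hsub hr) ht (sub_eq_zero.1 hXY))

lemma abs_sub_le_of_isIntegralCurveOn (hC : ∀ t x, |u t x| ≤ C)
    (hX : IsIntegralCurveOn X u (Icc 0 T)) {s t : ℝ} (hs : s ∈ Icc 0 T) (ht : t ∈ Icc 0 T) :
    |X t - X s| ≤ C * |t - s| :=
  (convex_Icc 0 T).norm_image_sub_le_of_norm_hasDerivWithin_le hX (fun _ _ => hC _ _) hs ht

lemma le_mul_exp_integral_of_deriv_add_nonneg {r r' c : ℝ → ℝ} {a b : ℝ} (hab : a ≤ b)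
    (hrc : ContinuousOn r (Icc a b)) (hr : ∀ s ∈ Ioo a b, HasDerivAt r (r' s) s)
    (hc : ContinuousOn c (Icc a b)) (h : ∀ s ∈ Ioo a b, 0 ≤ r' s + c s * r s) :
    r a ≤ r b * Real.exp (∫ s in a..b, c s) := by
  have hprim : ContinuousOn (fun z => ∫ s in a..z, c s) (Icc a b) := by
    rw [← uIcc_of_le hab] at hc ⊢
    exact intervalIntegral.continuousOn_primitive_interval hc.integrableOn_uIcc
  have hprim_deriv : ∀ z ∈ Ioo a b, HasDerivAt (fun z => ∫ s in a..z, c s) (c z) z := fun z hz =>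
    intervalIntegral.integral_hasDerivAt_right
      ((hc.mono (Icc_subset_Icc_right hz.2.le)).intervalIntegrable_of_Icc hz.1.le)
      ((hc.mono Ioo_subset_Icc_self).stronglyMeasurableAtFilter isOpen_Ioo z hz)
      (hc.continuousAt (Icc_mem_nhds hz.1 hz.2))
  have hderiv : ∀ z ∈ Ioo a b, HasDerivAt (fun z => r z * Real.exp (∫ s in a..z, c s))
      ((r' z + c z * r z) * Real.exp (∫ s in a..z, c s)) z := fun z hz => by
    refine ((hr z hz).fun_mul (hprim_deriv z hz).exp).congr_deriv ?_
    ring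
  have hmono : MonotoneOn (fun z => r z * Real.exp (∫ s in a..z, c s)) (Icc a b) := by
    refine monotoneOn_of_deriv_nonneg (convex_Icc a b) (hrc.mul hprim.rexp) ?_ ?_ <;>
      rw [interior_Icc]
    · exact fun z hz => (hderiv z hz).differentiableAt.differentiableWithinAt
    · intro z hz
      rw [(hderiv z hz).deriv]
      exact mul_nonneg (h z hz) (Real.exp_pos _).le
  simpa using hmono ⟨le_rfl, hab⟩ ⟨hab, le_rfl⟩ hab

lemma eq_mul_exp_integral_of_deriv_add_eq_zero {r r' c : ℝ → ℝ} {a b : ℝ} (hab : a ≤ b)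
    (hrc : ContinuousOn r (Icc a b)) (hr : ∀ s ∈ Ioo a b, HasDerivAt r (r' s) s)
    (hc : ContinuousOn c (Icc a b)) (h : ∀ s ∈ Ioo a b, r' s + c s * r s = 0) :
    r a = r b * Real.exp (∫ s in a..b, c s) := by
  refine le_antisymm
    (le_mul_exp_integral_of_deriv_add_nonneg hab hrc hr hc fun s hs => (h s hs).ge) ?_
  have hneg := le_mul_exp_integral_of_deriv_add_nonneg hab hrc.neg (fun s hs => (hr s hs).neg) hc
    fun s hs => by simp only [Pi.neg_apply]; linarith [h s hs]
  simp only [Pi.neg_apply] at hneg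
  linarith

end Characteristics

/-- The rate at which momentum enters a region through its right end point: viscous stress minus
convection and pressure, where `q = ρ e` is the internal energy per volume. -/
noncomputable def momentumFlux (ν γ : ℝ) (ρ u q : ℝ → ℝ → ℝ) (t x : ℝ) : ℝ :=
  ν * ∂ₓ u t x - ρ t x * u t x ^ 2 - (γ - 1) * q t x

/-- A solution `(ρ, u, q)`, `q = ρ e`, of the equations with viscosity `ν = 2μ + λ` whose fields are
`C¹`. The second space derivative of `u` need not exist everywhere, so the momentum balance is
integrated over intervals. -/
structure IsClassicalSolution (ν γ T : ℝ) (ρ u q : ℝ → ℝ → ℝ) : Prop where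
  density : IsC1Field T ρ
  velocity : IsC1Field T u
  internalEnergy : IsC1Field T q
  bounded : ∃ C : ℝ, ∀ t x, |ρ t x| ≤ C ∧ |u t x| ≤ C
  lipschitz : ∃ K : NNReal, ∀ t, LipschitzWith K (u t)
  memLp : ∀ t, MemLp (u t) 2 volume
  vacuum : ∀ t x, ρ t x = 0 → q t x = 0
  mass : ∀ t ∈ Ioo 0 T, ∀ x, ∂ₜ ρ t x + ∂ₓ (ρ * u) t x = 0
  momentum : ∀ t ∈ Ioo 0 T, ∀ a b,
    ∫ x in a..b, ∂ₜ (ρ * u) t x = momentumFlux ν γ ρ u q t b - momentumFlux ν γ ρ u q t a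
  energy : ∀ t ∈ Ioo 0 T, ∀ x,
    ∂ₜ q t x + ∂ₓ (q * u) t x + (γ - 1) * q t x * ∂ₓ u t x = ν * ∂ₓ u t x ^ 2

section Vacuum

lemma eq_zero_of_memLp_of_eqOn_Iio {f : ℝ → ℝ} {p : ENNReal} (hp : p ≠ 0) (hp' : p ≠ ⊤)
    (hf : MemLp f p volume) {a c : ℝ} (h : ∀ x < a, f x = c) : c = 0 := by
  have hconst : MemLp (fun _ : ℝ => c) p (volume.restrict (Iio a)) :=
    (hf.restrict (Iio a)).ae_eq ((ae_restrict_mem measurableSet_Iio).mono h)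
  simpa using (memLp_const_iff hp hp').1 hconst

namespace IsClassicalSolution

variable {ν γ T : ℝ} {ρ u q : ℝ → ℝ → ℝ} {X Z : ℝ → ℝ} {a t x : ℝ}

lemma exists_isIntegralCurveOn (h : IsClassicalSolution ν γ T ρ u q) (ht : t ∈ Icc 0 T) (x : ℝ) :
    ∃ X, X t = x ∧ IsIntegralCurveOn X u (Icc 0 T) := by
  obtain ⟨C, hC⟩ := h.bounded
  obtain ⟨K, hK⟩ := h.lipschitz
  exact FullNS.exists_isIntegralCurveOn h.velocity.continuous hK (fun t x => (hC t x).2) ht x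

lemma density_along (h : IsClassicalSolution ν γ T ρ u q) (hX : IsIntegralCurveOn X u (Icc 0 T))
    (ht : t ∈ Icc 0 T) :
    ρ 0 (X 0) = ρ t (X t) * Real.exp (∫ s in (0 : ℝ)..t, ∂ₓ u s (X s)) := by
  have hcurve : ContinuousOn (fun s => (s, X s)) (Icc 0 t) :=
    continuousOn_id.prodMk (hX.continuousOn.mono (Icc_subset_Icc_right ht.2))
  have hIoo : ∀ s ∈ Ioo 0 t, s ∈ Ioo 0 T := fun s hs => ⟨hs.1, hs.2.trans_le ht.2⟩
  refine eq_mul_exp_integral_of_deriv_add_eq_zero (r := fun s => ρ s (X s)) ht.1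
    (h.density.continuous.comp_continuousOn hcurve)
    (fun s hs => h.density.hasDerivAt_along (hIoo s hs)
      (hasDerivAt_of_isIntegralCurveOn hX (hIoo s hs)))
    (h.velocity.continuous_spaceDeriv.comp_continuousOn hcurve) fun s hs => ?_
  have hmass := h.mass s (hIoo s hs) (X s)
  rw [h.density.spaceDeriv_mul h.velocity] at hmass
  linarith

lemma internalEnergy_along (h : IsClassicalSolution ν γ T ρ u q) (hν : 0 ≤ ν)
    (hX : IsIntegralCurveOn X u (Icc 0 T)) (ht : t ∈ Icc 0 T) :
    q 0 (X 0) ≤ q t (X t) * Real.exp (∫ s in (0 : ℝ)..t, γ * ∂ₓ u s (X s)) := by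
  have hcurve : ContinuousOn (fun s => (s, X s)) (Icc 0 t) :=
    continuousOn_id.prodMk (hX.continuousOn.mono (Icc_subset_Icc_right ht.2))
  have hIoo : ∀ s ∈ Ioo 0 t, s ∈ Ioo 0 T := fun s hs => ⟨hs.1, hs.2.trans_le ht.2⟩
  refine le_mul_exp_integral_of_deriv_add_nonneg (r := fun s => q s (X s)) ht.1
    (h.internalEnergy.continuous.comp_continuousOn hcurve)
    (fun s hs => h.internalEnergy.hasDerivAt_along (hIoo s hs)
      (hasDerivAt_of_isIntegralCurveOn hX (hIoo s hs)))
    (continuousOn_const.mul (h.velocity.continuous_spaceDeriv.comp_continuousOn hcurve))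
    fun s hs => ?_
  have henergy := h.energy s (hIoo s hs) (X s)
  rw [h.internalEnergy.spaceDeriv_mul h.velocity] at henergy
  have hdissipation : 0 ≤ ν * ∂ₓ u s (X s) ^ 2 := by positivity
  linarith

lemma density_eq_zero_of_le_curve (h : IsClassicalSolution ν γ T ρ u q)
    (hZ : IsIntegralCurveOn Z u (Icc 0 T)) (h0 : ∀ x ≤ Z 0, ρ 0 x = 0) (ht : t ∈ Icc 0 T)
    (hx : x ≤ Z t) : ρ t x = 0 := by
  obtain ⟨K, hK⟩ := h.lipschitz
  obtain ⟨X, rfl, hX⟩ := h.exists_isIntegralCurveOn ht x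
  have hfoot : X 0 ≤ Z 0 := le_of_isIntegralCurveOn hK hX hZ ht ⟨le_rfl, ht.1.trans ht.2⟩ hx
  have hρ := h.density_along hX ht
  rw [h0 _ hfoot] at hρ
  exact (mul_eq_zero.1 hρ.symm).resolve_right (Real.exp_pos _).ne'

lemma spaceDeriv_velocity_eq_zero_of_eventually_vacuum (h : IsClassicalSolution ν γ T ρ u q)
    (hν : ν ≠ 0) (ht : t ∈ Ioo 0 T) (hvac : ∀ᶠ p in 𝓝 (t, x), ρ p.1 p.2 = 0) :
    ∂ₓ u t x = 0 := by
  have hq : ∀ᶠ p in 𝓝 (t, x), q p.1 p.2 = 0 := hvac.mono fun p hp => h.vacuum _ _ hp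
  have hqt : ∂ₜ q t x = 0 := by
    have hslice : (fun s => q s x) =ᶠ[𝓝 t] fun _ => 0 :=
      (continuous_id.prodMk continuous_const).continuousAt.eventually hq
    exact hslice.deriv_eq.trans (deriv_const t 0)
  have hqx : ∂ₓ q t x = 0 := by
    have hslice : q t =ᶠ[𝓝 x] fun _ => 0 :=
      (continuous_const.prodMk continuous_id).continuousAt.eventually hq
    exact hslice.deriv_eq.trans (deriv_const x 0)
  have henergy := h.energy t ht x
  rw [h.internalEnergy.spaceDeriv_mul h.velocity, hqt, hqx, hq.self_of_nhds] at henergy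
  simpa [hν] using henergy.symm

lemma spaceDeriv_velocity_eq_zero_of_lt_curve (h : IsClassicalSolution ν γ T ρ u q) (hν : ν ≠ 0)
    (hZ : IsIntegralCurveOn Z u (Icc 0 T)) (h0 : ∀ x ≤ Z 0, ρ 0 x = 0) (ht : t ∈ Ioo 0 T)
    (hx : x < Z t) : ∂ₓ u t x = 0 := by
  refine h.spaceDeriv_velocity_eq_zero_of_eventually_vacuum hν ht ?_
  have hZt : ContinuousAt Z t := (hasDerivAt_of_isIntegralCurveOn hZ ht).continuousAt
  filter_upwards [(continuousAt_snd (p := (t, x))).eventually_lt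
      (ContinuousAt.comp (g := Z) hZt continuousAt_fst) hx,
    continuousAt_fst.eventually (Ioo_mem_nhds ht.1 ht.2)] with p hp_lt hp_mem
  exact h.density_eq_zero_of_le_curve hZ h0 (Ioo_subset_Icc_self hp_mem) hp_lt.le

lemma velocity_eq_zero_of_le_curve (h : IsClassicalSolution ν γ T ρ u q) (hν : ν ≠ 0)
    (hZ : IsIntegralCurveOn Z u (Icc 0 T)) (h0 : ∀ x ≤ Z 0, ρ 0 x = 0) (ht : t ∈ Ioo 0 T)
    (hx : x ≤ Z t) : u t x = 0 := by
  have hconst : ∀ x < Z t, u t x = u t (Z t - 1) := fun x hx =>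
    isOpen_Iio.is_const_of_deriv_eq_zero isPreconnected_Iio
      (h.velocity.differentiable_space t).differentiableOn
      (fun _ hy => h.spaceDeriv_velocity_eq_zero_of_lt_curve hν hZ h0 ht hy) hx
      (sub_one_lt (Z t))
  have hzero := eq_zero_of_memLp_of_eqOn_Iio two_ne_zero ENNReal.ofNat_ne_top (h.memLp t) hconst
  have hEqOn : EqOn (u t) 0 (closure (Iio (Z t))) :=
    EqOn.closure (fun y hy => (hconst y hy).trans hzero) (h.velocity.continuous_slice t)
      continuous_zero
  exact hEqOn (by rwa [closure_Iio])

lemma curve_eq_of_vacuum (h : IsClassicalSolution ν γ T ρ u q) (hν : ν ≠ 0)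
    (hZ : IsIntegralCurveOn Z u (Icc 0 T)) (h0 : ∀ x ≤ Z 0, ρ 0 x = 0) (ht : t ∈ Icc 0 T) :
    Z t = Z 0 := by
  have hconst := eq_mul_exp_integral_of_deriv_add_eq_zero (c := 0) ht.1
    (hZ.continuousOn.mono (Icc_subset_Icc_right ht.2))
    (fun s hs => hasDerivAt_of_isIntegralCurveOn hZ ⟨hs.1, hs.2.trans_le ht.2⟩)
    continuousOn_const fun s hs => by
      simp [h.velocity_eq_zero_of_le_curve hν hZ h0 ⟨hs.1, hs.2.trans_le ht.2⟩ le_rfl]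
  simpa using hconst.symm

lemma isIntegralCurveOn_const (h : IsClassicalSolution ν γ T ρ u q) (hν : ν ≠ 0) (hT : 0 ≤ T)
    (h0 : ∀ x ≤ a, ρ 0 x = 0) : IsIntegralCurveOn (fun _ => a) u (Icc 0 T) := by
  obtain ⟨Z, rfl, hZ⟩ := h.exists_isIntegralCurveOn ⟨le_rfl, hT⟩ a
  intro t ht
  have hZt := hZ t ht
  rw [h.curve_eq_of_vacuum hν hZ h0 ht] at hZt
  exact hZt.congr (fun s hs => (h.curve_eq_of_vacuum hν hZ h0 hs).symm)
    (h.curve_eq_of_vacuum hν hZ h0 ht).symm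

lemma velocity_eq_zero_of_le (h : IsClassicalSolution ν γ T ρ u q) (hν : ν ≠ 0)
    (h0 : ∀ x ≤ a, ρ 0 x = 0) (ht : t ∈ Ioo 0 T) (hx : x ≤ a) : u t x = 0 :=
  h.velocity_eq_zero_of_le_curve hν (h.isIntegralCurveOn_const hν (ht.1.trans ht.2).le h0) h0 ht hx

lemma spaceDeriv_velocity_eq_zero (h : IsClassicalSolution ν γ T ρ u q) (hν : ν ≠ 0)
    (h0 : ∀ x ≤ a, ρ 0 x = 0) (ht : t ∈ Ioo 0 T) : ∂ₓ u t a = 0 := by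
  have hleft : HasDerivWithinAt (u t) 0 (Iic a) a :=
    (hasDerivWithinAt_const a (Iic a) (0 : ℝ)).congr
      (fun x hx => h.velocity_eq_zero_of_le hν h0 ht hx) (h.velocity_eq_zero_of_le hν h0 ht le_rfl)
  exact (uniqueDiffWithinAt_Iic a).eq_deriv _
    (h.velocity.hasDerivAt_space t a).hasDerivWithinAt hleft

lemma momentumFlux_eq_zero (h : IsClassicalSolution ν γ T ρ u q) (hν : ν ≠ 0)
    (h0 : ∀ x ≤ a, ρ 0 x = 0) (ht : t ∈ Ioo 0 T) : momentumFlux ν γ ρ u q t a = 0 := by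
  have hρ : ρ t a = 0 := h.density_eq_zero_of_le_curve
    (h.isIntegralCurveOn_const hν (ht.1.trans ht.2).le h0) h0 (Ioo_subset_Icc_self ht) le_rfl
  simp [momentumFlux, h.spaceDeriv_velocity_eq_zero hν h0 ht, hρ, h.vacuum t a hρ]

lemma curve_zero_mem_Ioo (h : IsClassicalSolution ν γ T ρ u q) (hν : ν ≠ 0)
    (h0 : ∀ x ≤ a, ρ 0 x = 0) {C r : ℝ} (hC : ∀ t x, |u t x| ≤ C)
    (hX : IsIntegralCurveOn X u (Icc 0 T)) (ht : t ∈ Icc 0 T) (ha : a < X t)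
    (hr : X t + C * t < r) : X 0 ∈ Ioo a r := by
  obtain ⟨K, hK⟩ := h.lipschitz
  have hT : (0 : ℝ) ≤ T := ht.1.trans ht.2
  have hmem : (0 : ℝ) ∈ Icc 0 T := ⟨le_rfl, hT⟩
  refine ⟨lt_of_not_ge fun hle => ha.not_ge <|
    le_of_isIntegralCurveOn hK hX (h.isIntegralCurveOn_const hν hT h0) hmem ht hle, ?_⟩
  have hdist := abs_sub_le_of_isIntegralCurveOn hC hX hmem ht
  rw [sub_zero, abs_of_nonneg ht.1] at hdist
  linarith [neg_abs_le (X t - X 0)]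

lemma density_pos (h : IsClassicalSolution ν γ T ρ u q) (hν : ν ≠ 0)
    (h0 : ∀ x ≤ a, ρ 0 x = 0) {C r : ℝ} (hC : ∀ t x, |u t x| ≤ C)
    (hpos : ∀ x ∈ Ioo a r, 0 < ρ 0 x) (ht : t ∈ Icc 0 T) (ha : a < x) (hr : x + C * t < r) :
    0 < ρ t x := by
  obtain ⟨X, rfl, hX⟩ := h.exists_isIntegralCurveOn ht x
  have hfoot := hpos _ (h.curve_zero_mem_Ioo hν h0 hC hX ht ha hr)
  rw [h.density_along hX ht] at hfoot
  exact pos_of_mul_pos_left hfoot (Real.exp_pos _).le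

lemma internalEnergy_nonneg (h : IsClassicalSolution ν γ T ρ u q) (hν : 0 < ν)
    (h0 : ∀ x ≤ a, ρ 0 x = 0) {C r : ℝ} (hC : ∀ t x, |u t x| ≤ C)
    (hnonneg : ∀ x ∈ Ioo a r, 0 ≤ q 0 x) (ht : t ∈ Icc 0 T) (ha : a < x) (hr : x + C * t < r) :
    0 ≤ q t x := by
  obtain ⟨X, rfl, hX⟩ := h.exists_isIntegralCurveOn ht x
  have hfoot := hnonneg _ (h.curve_zero_mem_Ioo hν.ne' h0 hC hX ht ha hr)
  exact nonneg_of_mul_nonneg_left (hfoot.trans (h.internalEnergy_along hν.le hX ht))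
    (Real.exp_pos _)

end IsClassicalSolution

end Vacuum

section MaximumPrinciple

lemma deriv_nonneg_of_isMaxOn_Icc_right {f : ℝ → ℝ} {f' a b : ℝ} (hab : a < b)
    (hf : HasDerivAt f f' b) (hmax : IsMaxOn f (Icc a b) b) : 0 ≤ f' := by
  have hcone : a - b ∈ posTangentConeAt (Icc a b) b :=
    sub_mem_posTangentConeAt_of_segment_subset
      ((convex_Icc a b).segment_subset (right_mem_Icc.2 hab.le) (left_mem_Icc.2 hab.le))
  have hnonpos := hmax.localize.hasFDerivWithinAt_nonpos hf.hasFDerivAt.hasFDerivWithinAt hcone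
  simp only [ContinuousLinearMap.toSpanSingleton_apply, smul_eq_mul] at hnonpos
  exact nonneg_of_mul_nonpos_right hnonpos (sub_neg.2 hab)

-- `D t x - κ t` with `κ > 0` small cannot attain a positive maximum over `[0, τ] × S` at `t > 0`.
lemma nonpos_of_hasDerivAt_nonpos_of_isMaxOn {E : Type*} [TopologicalSpace E] {S : Set E}
    (hS : IsCompact S) {τ : ℝ} {D : ℝ → E → ℝ}
    (hD : ContinuousOn (Function.uncurry D) (Icc 0 τ ×ˢ S)) (h0 : ∀ x ∈ S, D 0 x ≤ 0)
    (hmax : ∀ t ∈ Ioc 0 τ, ∀ x ∈ S, IsMaxOn (D t) S x → 0 < D t x →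
      ∃ d ≤ 0, HasDerivAt (fun s => D s x) d t)
    {t : ℝ} (ht : t ∈ Icc 0 τ) {x : E} (hx : x ∈ S) : D t x ≤ 0 := by
  by_contra! hpos
  obtain ⟨κ, hκ, hκt⟩ : ∃ κ > 0, κ * t < D t x := by
    have ht1 : 0 < t + 1 := by linarith [ht.1]
    refine ⟨D t x / (t + 1), div_pos hpos ht1, ?_⟩
    rw [div_mul_eq_mul_div, div_lt_iff₀ ht1]
    linarith
  obtain ⟨⟨t₀, x₀⟩, ⟨ht₀, hx₀⟩, hsup⟩ := (isCompact_Icc.prod hS).exists_isMaxOn ⟨(t, x), ht, hx⟩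
    (hD.sub (continuous_const.mul continuous_fst).continuousOn : ContinuousOn
      (fun p => D p.1 p.2 - κ * p.1) (Icc 0 τ ×ˢ S))
  replace hsup : ∀ s ∈ Icc 0 τ, ∀ y ∈ S, D s y - κ * s ≤ D t₀ x₀ - κ * t₀ :=
    fun s hs y hy => hsup (mk_mem_prod hs hy)
  have hpos₀ : 0 < D t₀ x₀ := by linarith [hsup t ht x hx, mul_nonneg hκ.le ht₀.1]
  have ht₀_pos : 0 < t₀ := ht₀.1.lt_of_ne fun h => hpos₀.not_ge (h ▸ h0 x₀ hx₀)
  obtain ⟨d, hd, hderiv⟩ := hmax t₀ ⟨ht₀_pos, ht₀.2⟩ x₀ hx₀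
    (fun y hy => by simpa using hsup t₀ ht₀ y hy) hpos₀
  have hslope : 0 ≤ d - κ * 1 :=
    deriv_nonneg_of_isMaxOn_Icc_right ht₀_pos (hderiv.sub ((hasDerivAt_id t₀).const_mul κ))
      fun s hs => hsup s ⟨hs.1, hs.2.trans ht₀.2⟩ x₀ hx₀
  linarith

lemma exists_integral_pos_of_eventually_pos {f : ℝ → ℝ} (hf : Continuous f) {a b : ℝ}
    (hab : a < b) (hpos : ∀ᶠ y in 𝓝[>] a, 0 < f y) : ∃ z ∈ Ioc a b, 0 < ∫ y in a..z, f y := by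
  obtain ⟨z, hz, hsub⟩ := (mem_nhdsGT_iff_exists_mem_Ioc_Ioo_subset hab).1 hpos
  exact ⟨z, hz, intervalIntegral.intervalIntegral_pos_of_pos_on (hf.intervalIntegrable _ _)
    (fun y hy => hsub hy) hz.1⟩

section WeightedPrimitive

variable {r w : ℝ → ℝ} {a l x : ℝ}

lemma mem_Ioo_of_isMaxOn_integral (hr : Continuous r) (hw : Continuous w)
    (hrpos : ∀ y ∈ Ioc a l, 0 < r y) (hwl : w l < 0) (hx : x ∈ Icc a l)
    (hmax : IsMaxOn (fun z => ∫ y in a..z, r y * w y) (Icc a l) x)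
    (hpos : 0 < ∫ y in a..x, r y * w y) : x ∈ Ioo a l := by
  have hax : a < x := hx.1.lt_of_ne fun h => by simp [h] at hpos
  refine ⟨hax, hx.2.lt_of_ne fun h => ?_⟩
  subst h
  exact (deriv_nonneg_of_isMaxOn_Icc_right hax
    ((hr.mul hw).integral_hasStrictDerivAt a x).hasDerivAt hmax).not_gt
    (mul_neg_of_pos_of_neg (hrpos x ⟨hax, le_rfl⟩) hwl)

lemma eq_zero_of_isMaxOn_integral (hr : Continuous r) (hw : Continuous w)
    (hrpos : ∀ y ∈ Ioc a l, 0 < r y) (hx : x ∈ Ioo a l)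
    (hmax : IsMaxOn (fun z => ∫ y in a..z, r y * w y) (Icc a l) x) : w x = 0 := by
  have hcrit : r x * w x = 0 := (hmax.isLocalMax (Icc_mem_nhds hx.1 hx.2)).hasDerivAt_eq_zero
    ((hr.mul hw).integral_hasStrictDerivAt a x).hasDerivAt
  exact (mul_eq_zero.1 hcrit).resolve_left (hrpos x ⟨hx.1, hx.2.le⟩).ne'

lemma deriv_nonpos_of_isMaxOn_integral (hr : Continuous r) (hw : Continuous w)
    (hrpos : ∀ y ∈ Ioc a l, 0 < r y) (hx : x ∈ Ioo a l)
    (hmax : IsMaxOn (fun z => ∫ y in a..z, r y * w y) (Icc a l) x) : deriv w x ≤ 0 := by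
  by_contra! hderiv
  have hsign := eventually_nhdsWithin_sign_eq_of_deriv_pos hderiv
    (eq_zero_of_isMaxOn_integral hr hw hrpos hx hmax)
  have hev : ∀ᶠ y in 𝓝[>] x, 0 < r y * w y := by
    filter_upwards [nhdsWithin_le_nhds hsign, Ioo_mem_nhdsGT hx.2] with y hy hxy
    rw [sign_pos (sub_pos.2 hxy.1), sign_eq_one_iff] at hy
    exact mul_pos (hrpos y ⟨hx.1.trans hxy.1, hxy.2.le⟩) hy
  have hrw : Continuous fun y => r y * w y := hr.mul hw
  obtain ⟨z, hz, hzpos⟩ := exists_integral_pos_of_eventually_pos hrw hx.2 hev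
  have hle : ∫ y in a..z, r y * w y ≤ ∫ y in a..x, r y * w y :=
    hmax (show z ∈ Icc a l from ⟨(hx.1.trans hz.1).le, hz.2⟩)
  have hadd := intervalIntegral.integral_add_adjacent_intervals
    (hrw.intervalIntegrable (μ := volume) a x) (hrw.intervalIntegrable x z)
  linarith

end WeightedPrimitive

end MaximumPrinciple

section Comparison

variable {ν γ T : ℝ} {ρ u q b : ℝ → ℝ → ℝ} {a t x : ℝ}

lemma IsC1Field.integral_spaceDeriv {f : ℝ → ℝ → ℝ} (hf : IsC1Field T f) (t a b : ℝ) :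
    ∫ x in a..b, ∂ₓ f t x = f t b - f t a :=
  intervalIntegral.integral_eq_sub_of_hasDerivAt (fun x _ => hf.hasDerivAt_space t x)
    ((hf.continuous_spaceDeriv_slice t).intervalIntegrable a b)

lemma IsC1Field.hasDerivAt_integral {f : ℝ → ℝ → ℝ} (hf : IsC1Field T f) (ht : t ∈ Ioo 0 T)
    (a b : ℝ) : HasDerivAt (fun s => ∫ x in a..b, f s x) (∫ x in a..b, ∂ₜ f t x) t := by
  obtain ⟨c, d, -, hnhds, hsub⟩ := exists_Icc_mem_subset_of_mem_nhds (Ioo_mem_nhds ht.1 ht.2)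
  obtain ⟨B, hB⟩ := (isCompact_Icc.prod isCompact_uIcc).exists_bound_of_continuousOn
    (hf.continuousOn_timeDeriv.mono (prod_mono hsub (subset_univ (uIcc a b))))
  exact (intervalIntegral.hasDerivAt_integral_of_dominated_loc_of_deriv_le (μ := volume)
    (bound := fun _ => B) hnhds
    (.of_forall fun s => (hf.continuous_slice s).aestronglyMeasurable)
    ((hf.continuous_slice t).intervalIntegrable a b)
    (hf.continuous_timeDeriv_slice ht).aestronglyMeasurable
    (.of_forall fun x hx s hs => hB (s, x) ⟨hs, uIoc_subset_uIcc hx⟩) intervalIntegrable_const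
    (.of_forall fun x _ s hs => hf.hasDerivAt_time (hsub hs) x)).2

/-- The momentum at time `t` of the gas between `a` and `x`, relative to the velocity field `b`. -/
noncomputable def relativeMomentum (ρ u b : ℝ → ℝ → ℝ) (a t x : ℝ) : ℝ :=
  ∫ y in a..x, ρ t y * (u t y - b t y)

lemma continuous_relativeMomentum (hρ : Continuous (Function.uncurry ρ))
    (hu : Continuous (Function.uncurry u)) (hb : Continuous (Function.uncurry b)) (a : ℝ) :
    Continuous (Function.uncurry (relativeMomentum ρ u b a)) := by
  have hintegrand : Continuous (Function.uncurry fun (p : ℝ × ℝ) y =>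
      ρ p.1 y * (u p.1 y - b p.1 y)) :=
    (hρ.mul (hu.sub hb)).comp ((continuous_fst.comp continuous_fst).prodMk continuous_snd)
  exact intervalIntegral.continuous_parametric_intervalIntegral_of_continuous hintegrand
    continuous_snd

/-- The velocity field `b` is an upper barrier for `u` on `[0, τ] × [a, l]`: it dominates `u` at
time `0` and at `l`, and satisfies the momentum inequality of a supersolution, integrated from the
vacuum boundary `a`. -/
structure IsUpperBarrier (ν τ a l : ℝ) (ρ u b : ℝ → ℝ → ℝ) : Prop where
  initial : ∀ x ∈ Ioc a l, u 0 x ≤ b 0 x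
  lateral : ∀ t ∈ Ioc 0 τ, u t l < b t l
  viscous : ∀ t ∈ Ioc 0 τ, ∀ x ∈ Ioo a l,
    ν * ∂ₓ b t x ≤ ∫ y in a..x, ρ t y * (u t y * ∂ₓ b t y + ∂ₜ b t y)

namespace IsClassicalSolution

lemma timeDeriv_density_mul_sub (h : IsClassicalSolution ν γ T ρ u q) (hb : IsC1Field T b)
    (ht : t ∈ Ioo 0 T) (x : ℝ) :
    ∂ₜ (ρ * (u - b)) t x = ∂ₜ (ρ * u) t x + ∂ₓ (ρ * u * b) t x
      - ρ t x * (u t x * ∂ₓ b t x + ∂ₜ b t x) := by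
  have hmass := h.mass t ht x
  rw [h.density.timeDeriv_mul (h.velocity.sub hb) ht, h.velocity.timeDeriv_sub hb ht,
    h.density.timeDeriv_mul h.velocity ht, (h.density.mul h.velocity).spaceDeriv_mul hb]
  simp only [Pi.sub_apply, Pi.mul_apply]
  linear_combination -b t x * hmass

lemma hasDerivAt_relativeMomentum (h : IsClassicalSolution ν γ T ρ u q) (hν : ν ≠ 0)
    (h0 : ∀ x ≤ a, ρ 0 x = 0) (hb : IsC1Field T b) (ht : t ∈ Ioo 0 T) (x : ℝ) :
    HasDerivAt (fun s => relativeMomentum ρ u b a s x)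
      (momentumFlux ν γ ρ u q t x + ρ t x * u t x * b t x
        - ∫ y in a..x, ρ t y * (u t y * ∂ₓ b t y + ∂ₜ b t y)) t := by
  have hρ := h.density.continuous_slice t
  have hu := h.velocity.continuous_slice t
  have hbx := hb.continuous_spaceDeriv_slice t
  have hbt := hb.continuous_timeDeriv_slice ht
  have hflux := h.density.mul h.velocity
  refine ((h.density.mul (h.velocity.sub hb)).hasDerivAt_integral ht a x).congr_deriv ?_
  have hua : u t a = 0 := h.velocity_eq_zero_of_le hν h0 ht le_rfl
  calc ∫ y in a..x, ∂ₜ (ρ * (u - b)) t y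
      = ∫ y in a..x, (∂ₜ (ρ * u) t y + ∂ₓ (ρ * u * b) t y
          - ρ t y * (u t y * ∂ₓ b t y + ∂ₜ b t y)) := by
        simp only [h.timeDeriv_density_mul_sub hb ht]
    _ = (∫ y in a..x, ∂ₜ (ρ * u) t y) + (∫ y in a..x, ∂ₓ (ρ * u * b) t y)
          - ∫ y in a..x, ρ t y * (u t y * ∂ₓ b t y + ∂ₜ b t y) := by
        have hint_t := (hflux.continuous_timeDeriv_slice ht).intervalIntegrable (μ := volume) a x
        have hint_x :=
          ((hflux.mul hb).continuous_spaceDeriv_slice t).intervalIntegrable (μ := volume) a x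
        rw [intervalIntegral.integral_sub (hint_t.add hint_x)
          (Continuous.intervalIntegrable (by fun_prop) a x),
          intervalIntegral.integral_add hint_t hint_x]
    _ = _ := by
        rw [h.momentum t ht, (hflux.mul hb).integral_spaceDeriv, h.momentumFlux_eq_zero hν h0 ht]
        simp [hua]

lemma momentumRate_nonpos_of_isMaxOn (h : IsClassicalSolution ν γ T ρ u q) (hν : 0 ≤ ν)
    (hγ : 1 ≤ γ) (hb : IsC1Field T b) {l : ℝ} (hρ : ∀ x ∈ Ioc a l, 0 < ρ t x) (hq : 0 ≤ q t x)
    (hx : x ∈ Ioo a l) (hmax : IsMaxOn (relativeMomentum ρ u b a t) (Icc a l) x)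
    (hviscous : ν * ∂ₓ b t x ≤ ∫ y in a..x, ρ t y * (u t y * ∂ₓ b t y + ∂ₜ b t y)) :
    momentumFlux ν γ ρ u q t x + ρ t x * u t x * b t x
      - ∫ y in a..x, ρ t y * (u t y * ∂ₓ b t y + ∂ₜ b t y) ≤ 0 := by
  have hρt := h.density.continuous_slice t
  have hw : Continuous fun y => u t y - b t y := (h.velocity.sub hb).continuous_slice t
  have hub : u t x - b t x = 0 :=
    eq_zero_of_isMaxOn_integral (w := fun y => u t y - b t y) hρt hw hρ hx hmax
  have hslope : ∂ₓ (u - b) t x ≤ 0 := deriv_nonpos_of_isMaxOn_integral hρt hw hρ hx hmax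
  rw [h.velocity.spaceDeriv_sub hb, sub_nonpos] at hslope
  have hstress : ν * ∂ₓ u t x ≤ ν * ∂ₓ b t x := by gcongr
  have hpressure : 0 ≤ (γ - 1) * q t x := mul_nonneg (sub_nonneg.2 hγ) hq
  have hconvection : ρ t x * u t x * b t x = ρ t x * u t x ^ 2 := by rw [← sub_eq_zero.1 hub]; ring
  rw [momentumFlux]
  linarith

theorem relativeMomentum_nonpos (h : IsClassicalSolution ν γ T ρ u q) (hν : 0 < ν) (hγ : 1 ≤ γ)
    (h0 : ∀ x ≤ a, ρ 0 x = 0) {τ l : ℝ} (hτ : τ < T)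
    (hρ : ∀ t ∈ Icc 0 τ, ∀ x ∈ Ioc a l, 0 < ρ t x) (hq : ∀ t ∈ Icc 0 τ, ∀ x ∈ Ioc a l, 0 ≤ q t x)
    (hb : IsC1Field T b) (hbarrier : IsUpperBarrier ν τ a l ρ u b) (ht : t ∈ Icc 0 τ)
    (hx : x ∈ Icc a l) : relativeMomentum ρ u b a t x ≤ 0 := by
  have hw := fun t => (h.velocity.sub hb).continuous_slice t
  refine nonpos_of_hasDerivAt_nonpos_of_isMaxOn isCompact_Icc
    (continuous_relativeMomentum h.density.continuous h.velocity.continuous hb.continuous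
      a).continuousOn (fun x hx => ?_) (fun t ht x hx hmax hpos => ?_) ht hx
  · rw [relativeMomentum, intervalIntegral.integral_of_le hx.1]
    refine setIntegral_nonpos measurableSet_Ioc fun y hy => ?_
    have hy' : y ∈ Ioc a l := ⟨hy.1, hy.2.trans hx.2⟩
    exact mul_nonpos_of_nonneg_of_nonpos (hρ 0 ⟨le_rfl, ht.1.trans ht.2⟩ y hy').le
      (sub_nonpos.2 (hbarrier.initial y hy'))
  · have htT : t ∈ Ioo 0 T := ⟨ht.1, ht.2.trans_lt hτ⟩
    have ht' := Ioc_subset_Icc_self ht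
    have hx' : x ∈ Ioo a l := mem_Ioo_of_isMaxOn_integral (h.density.continuous_slice t) (hw t)
      (hρ t ht') (sub_neg.2 (hbarrier.lateral t ht)) hx hmax hpos
    exact ⟨_, h.momentumRate_nonpos_of_isMaxOn hν.le hγ hb (hρ t ht')
      (hq t ht' x (Ioo_subset_Ioc_self hx')) hx' hmax (hbarrier.viscous t ht x hx'),
      h.hasDerivAt_relativeMomentum hν.ne' h0 hb htT x⟩

end IsClassicalSolution

/-- An exponential wave of speed `-L`, vanishing at `p` at time `0`. -/
noncomputable def barrier (ε K L p t x : ℝ) : ℝ := ε * (1 - Real.exp (K * (x - p + L * t)))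

variable {ε K L p : ℝ}

lemma hasDerivAt_barrier_space (t x : ℝ) :
    HasDerivAt (barrier ε K L p t) (K * (barrier ε K L p t x - ε)) x := by
  have hphase : HasDerivAt (fun x => K * (x - p + L * t)) K x := by
    simpa using (((hasDerivAt_id x).sub_const p).add_const (L * t)).const_mul K
  exact ((hphase.exp.const_sub 1).const_mul ε).congr_deriv (by rw [barrier]; ring)

lemma hasDerivAt_barrier_time (t x : ℝ) :
    HasDerivAt (fun s => barrier ε K L p s x) (L * (K * (barrier ε K L p t x - ε))) t := by
  have hphase : HasDerivAt (fun t => K * (x - p + L * t)) (K * L) t := by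
    simpa using (((hasDerivAt_id t).const_mul L).const_add (x - p)).const_mul K
  exact ((hphase.exp.const_sub 1).const_mul ε).congr_deriv (by rw [barrier]; ring)

lemma spaceDeriv_barrier (t x : ℝ) :
    ∂ₓ (barrier ε K L p) t x = K * (barrier ε K L p t x - ε) :=
  (hasDerivAt_barrier_space t x).deriv

lemma timeDeriv_barrier (t x : ℝ) :
    ∂ₜ (barrier ε K L p) t x = L * ∂ₓ (barrier ε K L p) t x := by
  rw [spaceDeriv_barrier]
  exact (hasDerivAt_barrier_time t x).deriv

lemma isC1Field_barrier (T ε K L p : ℝ) : IsC1Field T (barrier ε K L p) :=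
  have hcont : Continuous (Function.uncurry (barrier ε K L p)) := by
    unfold barrier Function.uncurry
    fun_prop
  .of_hasDerivAt hasDerivAt_barrier_space (fun t _ x => hasDerivAt_barrier_time t x) hcont
    (continuous_const.mul (hcont.sub continuous_const))
    (continuous_const.mul (continuous_const.mul (hcont.sub continuous_const))).continuousOn

lemma barrier_lt (hε : 0 < ε) (t x : ℝ) : barrier ε K L p t x < ε := by
  have := mul_pos hε (Real.exp_pos (K * (x - p + L * t)))
  rw [barrier]
  linarith

lemma barrier_nonneg (hε : 0 ≤ ε) (hK : 0 ≤ K) (hx : x + L * t ≤ p) :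
    0 ≤ barrier ε K L p t x :=
  mul_nonneg hε (sub_nonneg.2 (Real.exp_le_one_iff.2
    (mul_nonpos_of_nonneg_of_nonpos hK (by linarith))))

lemma barrier_neg (hε : 0 < ε) (hK : 0 < K) (hx : p < x + L * t) : barrier ε K L p t x < 0 :=
  mul_neg_of_pos_of_neg hε (sub_neg.2 (Real.one_lt_exp_iff.2 (mul_pos hK (by linarith))))

lemma neg_lt_barrier (hε : 0 < ε) (hK : 0 ≤ K) (hL : 0 ≤ L) {τ l c : ℝ}
    (hc : ε * Real.exp (K * (l - p + L * τ)) ≤ c) (ht : t ≤ τ) (hx : x ≤ l) :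
    -c < barrier ε K L p t x := by
  have hexp : ε * Real.exp (K * (x - p + L * t)) ≤ ε * Real.exp (K * (l - p + L * τ)) := by gcongr
  rw [barrier]
  linarith

lemma mul_spaceDeriv_barrier_le_integral (hε : 0 < ε) (hK : 0 ≤ K) {g : ℝ → ℝ}
    (hg : Continuous g) {M : ℝ} (hM : 0 ≤ M) (hMK : M ≤ ν * K) (hgM : ∀ y ∈ Ioo a x, g y ≤ M)
    (hax : a ≤ x) :
    ν * ∂ₓ (barrier ε K L p) t x ≤ ∫ y in a..x, g y * ∂ₓ (barrier ε K L p) t y := by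
  have hC1 := isC1Field_barrier 0 ε K L p
  have hbx := hC1.continuous_spaceDeriv_slice t
  have hlt : ∀ y, barrier ε K L p t y - ε ≤ 0 := fun y => (sub_neg.2 (barrier_lt hε t y)).le
  calc ν * ∂ₓ (barrier ε K L p) t x = ν * K * (barrier ε K L p t x - ε) := by
        rw [spaceDeriv_barrier, mul_assoc]
    _ ≤ M * (barrier ε K L p t x - ε) := mul_le_mul_of_nonpos_right hMK (hlt x)
    _ ≤ M * (barrier ε K L p t x - barrier ε K L p t a) := by
        gcongr
        exact (barrier_lt hε t a).le
    _ = ∫ y in a..x, M * ∂ₓ (barrier ε K L p) t y := by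
        rw [intervalIntegral.integral_const_mul, hC1.integral_spaceDeriv]
    _ ≤ _ := intervalIntegral.integral_mono_on_of_le_Ioo hax
        (Continuous.intervalIntegrable (by fun_prop) a x)
        (Continuous.intervalIntegrable (by fun_prop) a x) fun y hy =>
          mul_le_mul_of_nonpos_right (hgM y hy) <| by
            rw [spaceDeriv_barrier]
            exact mul_nonpos_of_nonneg_of_nonpos hK (hlt y)

-- `L` moves the zero of the barrier past `a` before time `τ`, `K` yields the viscous inequality
-- and `ε` keeps the barrier above `-c`.
theorem exists_isUpperBarrier (hν : 0 < ν) {τ l c C : ℝ} (hτ : 0 < τ) (hp : p ∈ Ioo a l)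
    (hc : 0 < c) (hρcont : ∀ t, Continuous (ρ t)) (hucont : ∀ t, Continuous (u t))
    (hρ : ∀ t ∈ Ioc 0 τ, ∀ x ∈ Ioo a l, 0 ≤ ρ t x) (hC : ∀ t x, ρ t x ≤ C ∧ u t x ≤ C)
    (hC0 : 0 ≤ C) (hu : ∀ x ∈ Ioc a p, u 0 x ≤ 0)
    (huc : ∀ t ∈ Icc 0 τ, ∀ x ∈ Icc p l, u t x ≤ -c) :
    ∃ b, IsC1Field T b ∧ IsUpperBarrier ν τ a l ρ u b ∧ b τ a < 0 := by
  obtain ⟨L, hL, hLτ⟩ : ∃ L > 0, L * τ = 2 * (p - a) :=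
    ⟨2 * (p - a) / τ, by have := sub_pos.2 hp.1; positivity, div_mul_cancel₀ _ hτ.ne'⟩
  obtain ⟨K, hK, hνK⟩ : ∃ K > 0, C * (C + L) ≤ ν * K :=
    ⟨(C * (C + L) + 1) / ν, by positivity, by rw [mul_div_cancel₀ _ hν.ne']; linarith⟩
  obtain ⟨ε, hε, hεc⟩ : ∃ ε > 0, ε * Real.exp (K * (l - p + L * τ)) ≤ c :=
    ⟨c / Real.exp (K * (l - p + L * τ)), by positivity, by rw [div_mul_cancel₀ _ (by positivity)]⟩
  refine ⟨barrier ε K L p, isC1Field_barrier T ε K L p, ⟨fun x hx => ?_, fun t ht => ?_,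
    fun t ht x hx => ?_⟩, barrier_neg hε hK (by linarith [hp.1])⟩
  · rcases le_or_gt x p with hxp | hxp
    · exact (hu x ⟨hx.1, hxp⟩).trans (barrier_nonneg hε.le hK.le (by simpa using hxp))
    · exact (huc 0 ⟨le_rfl, hτ.le⟩ x ⟨hxp.le, hx.2⟩).trans
        (neg_lt_barrier hε hK.le hL.le hεc hτ.le hx.2).le
  · exact (huc t (Ioc_subset_Icc_self ht) l ⟨hp.2.le, le_rfl⟩).trans_lt
      (neg_lt_barrier hε hK.le hL.le hεc ht.2 le_rfl)
  · have hbound : ∀ y ∈ Ioo a x, ρ t y * (u t y + L) ≤ C * (C + L) := fun y hy => by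
      have hρy := hρ t ht y ⟨hy.1, hy.2.trans hx.2⟩
      calc ρ t y * (u t y + L) ≤ ρ t y * (C + L) := by gcongr; exact (hC t y).2
        _ ≤ C * (C + L) := by gcongr; exact (hC t y).1
    have hcont : Continuous fun y => ρ t y * (u t y + L) :=
      (hρcont t).mul ((hucont t).add continuous_const)
    refine (mul_spaceDeriv_barrier_le_integral hε hK.le hcont (by positivity) hνK hbound
      hx.1.le).trans_eq (intervalIntegral.integral_congr fun y _ => ?_)
    simp only [timeDeriv_barrier]
    ring

end Comparison

section Outflow

/-- Gas occupying `(a, r)` next to the vacuum `(-∞, a]` moves towards the vacuum: `u₀` is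
nonpositive up to some point `l` of the gas, and negative at `l`. -/
def HasLeftOutflow (ρ₀ u₀ e₀ : ℝ → ℝ) : Prop :=
  ∃ a l r : ℝ, l ∈ Ioo a r ∧ (∀ x ≤ a, ρ₀ x = 0) ∧ (∀ x ∈ Ioo a r, 0 < ρ₀ x ∧ 0 ≤ e₀ x) ∧
    u₀ l < 0 ∧ ∀ x ∈ Ioo a l, u₀ x ≤ 0

/-- The mirror image of `HasLeftOutflow`, with the vacuum `[a, ∞)` to the right of the gas. -/
def HasRightOutflow (ρ₀ u₀ e₀ : ℝ → ℝ) : Prop :=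
  ∃ r l a : ℝ, l ∈ Ioo r a ∧ (∀ x, a ≤ x → ρ₀ x = 0) ∧ (∀ x ∈ Ioo r a, 0 < ρ₀ x ∧ 0 ≤ e₀ x) ∧
    0 < u₀ l ∧ ∀ x ∈ Ioo l a, 0 ≤ u₀ x

variable {ρ₀ u₀ e₀ : ℝ → ℝ}

lemma HasLeftOutflow.mul_energy :
    HasLeftOutflow ρ₀ u₀ e₀ → HasLeftOutflow ρ₀ u₀ (ρ₀ * e₀)
  | ⟨a, l, r, hl, hvac, hgas, hul, hu⟩ =>
    ⟨a, l, r, hl, hvac, fun x hx => ⟨(hgas x hx).1, mul_nonneg (hgas x hx).1.le (hgas x hx).2⟩,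
      hul, hu⟩

lemma HasRightOutflow.mul_energy :
    HasRightOutflow ρ₀ u₀ e₀ → HasRightOutflow ρ₀ u₀ (ρ₀ * e₀)
  | ⟨r, l, a, hl, hvac, hgas, hul, hu⟩ =>
    ⟨r, l, a, hl, hvac, fun x hx => ⟨(hgas x hx).1, mul_nonneg (hgas x hx).1.le (hgas x hx).2⟩,
      hul, hu⟩

lemma HasRightOutflow.comp_neg :
    HasRightOutflow ρ₀ u₀ e₀ →
      HasLeftOutflow (fun x => ρ₀ (-x)) (fun x => -u₀ (-x)) fun x => e₀ (-x)
  | ⟨r, l, a, hl, hvac, hgas, hul, hu⟩ => by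
    refine ⟨-a, -l, -r, ⟨neg_lt_neg hl.2, neg_lt_neg hl.1⟩,
      fun x hx => hvac _ (le_neg_of_le_neg hx),
      fun x hx => hgas _ ⟨lt_neg_of_lt_neg hx.2, neg_lt_of_neg_lt hx.1⟩, by simpa using hul,
      fun x hx => neg_nonpos.2 (hu _ ⟨lt_neg_of_lt_neg hx.2, neg_lt_of_neg_lt hx.1⟩)⟩

lemma exists_Icc_forall_lt_of_continuous {f : ℝ → ℝ → ℝ} (hf : Continuous (Function.uncurry f))
    {t₀ a l c : ℝ} (hal : a < l) (hc : f t₀ l < c) :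
    ∃ p ∈ Ioo a l, ∃ δ > t₀, ∀ t ∈ Icc t₀ δ, ∀ x ∈ Icc p l, f t x < c := by
  have hev : {z | Function.uncurry f z < c} ∈ 𝓝 (t₀, l) :=
    hf.continuousAt.eventually_lt continuousAt_const hc
  obtain ⟨U, hU, V, hV, hUV⟩ := mem_nhds_prod_iff.1 hev
  obtain ⟨δ, hδ, hδU⟩ := mem_nhdsGE_iff_exists_Icc_subset.1 (mem_nhdsWithin_of_mem_nhds hU)
  obtain ⟨p, hp, hpV⟩ := mem_nhdsLE_iff_exists_Icc_subset.1
    (mem_nhdsWithin_of_mem_nhds (inter_mem hV (Ioi_mem_nhds hal)))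
  exact ⟨p, ⟨(hpV ⟨le_rfl, hp.le⟩).2, hp⟩, δ, hδ, fun t ht x hx =>
    hUV (mk_mem_prod (hδU ht) (hpV hx).1)⟩

lemma exists_outflow_window {u : ℝ → ℝ → ℝ} (hu : Continuous (Function.uncurry u))
    {T C a l r : ℝ} (hT : 0 < T) (hl : l ∈ Ioo a r) (hul : u 0 l < 0) :
    ∃ c > 0, ∃ p ∈ Ioo a l, ∃ τ ∈ Ioo 0 T, l + C * τ < r ∧
      ∀ t ∈ Icc 0 τ, ∀ x ∈ Icc p l, u t x < -c := by
  obtain ⟨d, hud, hd⟩ := exists_between hul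
  obtain ⟨p, hp, δ, hδ, hwindow⟩ := exists_Icc_forall_lt_of_continuous hu hl.1 hud
  have hr : ∀ᶠ τ in 𝓝 (0 : ℝ), l + C * τ < r :=
    (continuous_const.add (continuous_const.mul continuous_id)).continuousAt.eventually_lt
      continuousAt_const (by simpa using hl.2)
  have hsmall : ∀ᶠ τ in 𝓝[>] (0 : ℝ), l + C * τ < r ∧ τ < δ ∧ τ < T :=
    nhdsWithin_le_nhds (hr.and ((gt_mem_nhds hδ).and (gt_mem_nhds hT)))
  obtain ⟨τ, ⟨hτr, hτδ, hτT⟩, hτ⟩ := (hsmall.and eventually_mem_nhdsWithin).exists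
  refine ⟨-d, neg_pos.2 hd, p, hp, τ, ⟨hτ, hτT⟩, hτr, fun t ht x hx => ?_⟩
  simpa using hwindow t ⟨ht.1, ht.2.trans hτδ.le⟩ x hx

namespace IsClassicalSolution

variable {ν γ T : ℝ} {ρ u q b : ℝ → ℝ → ℝ} {a l t : ℝ}

lemma exists_relativeMomentum_pos (h : IsClassicalSolution ν γ T ρ u q) (hν : ν ≠ 0)
    (h0 : ∀ x ≤ a, ρ 0 x = 0) (hb : IsC1Field T b) (ht : t ∈ Ioo 0 T) (hal : a < l)
    (hρ : ∀ x ∈ Ioc a l, 0 < ρ t x) (hba : b t a < 0) :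
    ∃ x ∈ Ioc a l, 0 < relativeMomentum ρ u b a t x := by
  have hw : Continuous fun y => u t y - b t y := (h.velocity.sub hb).continuous_slice t
  have hwa : 0 < u t a - b t a := by
    rw [h.velocity_eq_zero_of_le hν h0 ht le_rfl]
    linarith
  refine exists_integral_pos_of_eventually_pos ((h.density.continuous_slice t).mul hw) hal ?_
  filter_upwards [nhdsWithin_le_nhds (hw.continuousAt.eventually (lt_mem_nhds hwa)),
    Ioc_mem_nhdsGT hal] with y hwy hy
  exact mul_pos (hρ y hy) hwy

theorem not_hasLeftOutflow (h : IsClassicalSolution ν γ T ρ u q) (hν : 0 < ν) (hγ : 1 ≤ γ)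
    (hT : 0 < T) : ¬ HasLeftOutflow (ρ 0) (u 0) (q 0) := by
  rintro ⟨a, l, r, hl, h0, hgas, hul, hu⟩
  obtain ⟨C, hC⟩ := h.bounded
  have hC0 : 0 ≤ C := (abs_nonneg _).trans (hC 0 0).1
  obtain ⟨c, hc, p, hp, τ, hτ, hτr, hwindow⟩ :=
    exists_outflow_window (C := C) h.velocity.continuous hT hl hul
  have htT : ∀ t ∈ Icc 0 τ, t ∈ Icc 0 T := fun t ht => ⟨ht.1, ht.2.trans hτ.2.le⟩
  have hcone : ∀ t ∈ Icc 0 τ, ∀ x ∈ Ioc a l, x + C * t < r := fun t ht x hx => by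
    have : C * t ≤ C * τ := by gcongr; exact ht.2
    linarith [hx.2]
  have hρ : ∀ t ∈ Icc 0 τ, ∀ x ∈ Ioc a l, 0 < ρ t x := fun t ht x hx =>
    h.density_pos hν.ne' h0 (fun t x => (hC t x).2) (fun x hx => (hgas x hx).1) (htT t ht) hx.1
      (hcone t ht x hx)
  have hq : ∀ t ∈ Icc 0 τ, ∀ x ∈ Ioc a l, 0 ≤ q t x := fun t ht x hx =>
    h.internalEnergy_nonneg hν h0 (fun t x => (hC t x).2) (fun x hx => (hgas x hx).2) (htT t ht)
      hx.1 (hcone t ht x hx)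
  obtain ⟨b, hb, hbarrier, hba⟩ := exists_isUpperBarrier (T := T) hν hτ.1 hp hc
    h.density.continuous_slice h.velocity.continuous_slice
    (fun t ht x hx => (hρ t (Ioc_subset_Icc_self ht) x (Ioo_subset_Ioc_self hx)).le)
    (fun t x => ⟨(le_abs_self _).trans (hC t x).1, (le_abs_self _).trans (hC t x).2⟩) hC0
    (fun x hx => hu x ⟨hx.1, hx.2.trans_lt hp.2⟩) fun t ht x hx => (hwindow t ht x hx).le
  have hτmem : τ ∈ Icc 0 τ := ⟨hτ.1.le, le_rfl⟩
  obtain ⟨x, hx, hpos⟩ := h.exists_relativeMomentum_pos hν.ne' h0 hb hτ hl.1 (hρ τ hτmem) hba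
  exact hpos.not_ge (h.relativeMomentum_nonpos hν hγ h0 hτ.2 hρ hq hb hbarrier hτmem
    (Ioc_subset_Icc_self hx))

end IsClassicalSolution

end Outflow

section Reflection

/-- The mirror image `(t, x) ↦ f t (-x)` of a function of `(t, x)`. -/
def reflect (f : ℝ → ℝ → ℝ) (t x : ℝ) : ℝ := f t (-x)

variable {ν γ T : ℝ} {f ρ u q : ℝ → ℝ → ℝ}

lemma spaceDeriv_reflect (f : ℝ → ℝ → ℝ) : ∂ₓ (reflect f) = -reflect (∂ₓ f) :=
  funext₂ fun t x => deriv_comp_neg (f t) x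

lemma timeDeriv_reflect (f : ℝ → ℝ → ℝ) : ∂ₜ (reflect f) = reflect (∂ₜ f) := rfl

lemma spaceDeriv_neg (f : ℝ → ℝ → ℝ) : ∂ₓ (-f) = -∂ₓ f := funext₂ fun _ _ => deriv.neg

lemma timeDeriv_neg (f : ℝ → ℝ → ℝ) : ∂ₜ (-f) = -∂ₜ f := funext₂ fun _ _ => deriv.fun_neg

lemma reflect_mul_neg_reflect (f g : ℝ → ℝ → ℝ) : reflect f * -reflect g = -reflect (f * g) :=
  mul_neg _ _

lemma momentumFlux_reflect (ν γ : ℝ) (ρ u q : ℝ → ℝ → ℝ) (t x : ℝ) :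
    momentumFlux ν γ (reflect ρ) (-reflect u) (reflect q) t x = momentumFlux ν γ ρ u q t (-x) := by
  simp [momentumFlux, spaceDeriv_neg, spaceDeriv_reflect, reflect]

namespace IsC1Field

protected lemma neg (hf : IsC1Field T f) : IsC1Field T (-f) :=
  of_hasDerivAt (fun t x => (hf.hasDerivAt_space t x).neg)
    (fun _ ht x => (hf.hasDerivAt_time ht x).neg) hf.continuous.neg hf.continuous_spaceDeriv.neg
    hf.continuousOn_timeDeriv.neg

protected lemma reflect (hf : IsC1Field T f) : IsC1Field T (reflect f) :=
  have hneg : Continuous fun p : ℝ × ℝ => (p.1, -p.2) := continuous_fst.prodMk continuous_snd.neg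
  of_hasDerivAt (fx := -reflect (∂ₓ f))
    (fun t x => ((hf.hasDerivAt_space t (-x)).comp x (hasDerivAt_neg x)).congr_deriv
      (mul_neg_one _)) (fun _ ht x => hf.hasDerivAt_time ht (-x)) (hf.continuous.comp hneg)
    (hf.continuous_spaceDeriv.comp hneg).neg
    (hf.continuousOn_timeDeriv.comp hneg.continuousOn fun _ hp => ⟨hp.1, mem_univ _⟩)

end IsC1Field

namespace IsClassicalSolution

protected lemma reflect (h : IsClassicalSolution ν γ T ρ u q) :
    IsClassicalSolution ν γ T (reflect ρ) (-reflect u) (reflect q) where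
  density := h.density.reflect
  velocity := h.velocity.reflect.neg
  internalEnergy := h.internalEnergy.reflect
  bounded := by
    obtain ⟨C, hC⟩ := h.bounded
    exact ⟨C, fun t x => by simpa [reflect] using hC t (-x)⟩
  lipschitz := by
    obtain ⟨K, hK⟩ := h.lipschitz
    refine ⟨K, fun t => ?_⟩
    have hcomp := ((hK t).comp LipschitzWith.id.neg).neg
    rwa [mul_one] at hcomp
  memLp t := ((h.memLp t).comp_measurePreserving (Measure.measurePreserving_neg volume)).neg
  vacuum t x := h.vacuum t (-x)
  mass t ht x := by
    rw [reflect_mul_neg_reflect, spaceDeriv_neg, spaceDeriv_reflect, neg_neg, timeDeriv_reflect]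
    exact h.mass t ht (-x)
  momentum t ht a b := by
    rw [reflect_mul_neg_reflect, timeDeriv_neg, timeDeriv_reflect, momentumFlux_reflect,
      momentumFlux_reflect]
    calc ∫ x in a..b, -∂ₜ (ρ * u) t (-x) = -∫ x in -b..-a, ∂ₜ (ρ * u) t x := by
          rw [intervalIntegral.integral_neg, intervalIntegral.integral_comp_neg]
      _ = _ := by rw [h.momentum t ht, neg_sub]
  energy t ht x := by
    rw [reflect_mul_neg_reflect, spaceDeriv_neg, spaceDeriv_reflect, spaceDeriv_neg,
      spaceDeriv_reflect, neg_neg, neg_neg, timeDeriv_reflect]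
    exact h.energy t ht (-x)

theorem not_hasRightOutflow (h : IsClassicalSolution ν γ T ρ u q) (hν : 0 < ν) (hγ : 1 ≤ γ)
    (hT : 0 < T) : ¬ HasRightOutflow (ρ 0) (u 0) (q 0) :=
  fun hout => h.reflect.not_hasLeftOutflow hν hγ hT hout.comp_neg

end IsClassicalSolution

end Reflection

section FourierMultipliers

open FourierTransform ENNReal
open scoped BoundedContinuousFunction

local notation "L²" => Lp ℂ 2 (volume : Measure ℝ)

/-- The inverse Fourier transform of `w G` for `w, G ∈ L²`, as a bounded continuous function. -/
noncomputable def invFourierMul (w : L²) : L² →L[ℂ] (ℝ →ᵇ ℂ) :=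
  Real.Lp.fourierTransformInvCLM ℝ ℂ ∘L
    (ContinuousLinearMap.holderL volume 2 2 1 (ContinuousLinearMap.mul ℂ ℂ) w)

/-- Multiplication by a bounded function on `L²`. -/
noncomputable def mulBounded (w : Lp ℂ ∞ (volume : Measure ℝ)) : L² →L[ℂ] L² :=
  ContinuousLinearMap.holderL volume ∞ 2 2 (ContinuousLinearMap.mul ℂ ℂ) w

variable {w w' : ℝ → ℂ}

lemma invFourierMul_toLp_apply (hw : MemLp w 2 volume) (G : L²) (x : ℝ) :
    invFourierMul (hw.toLp w) G x = 𝓕⁻ (fun ξ => w ξ * G ξ) x := by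
  simp only [invFourierMul, ContinuousLinearMap.comp_apply, Real.Lp.fourierTransformInvCLM_apply,
    Real.Lp.fourierTransformInv_apply]
  refine Real.fourierInv_congr_ae ?_ x
  filter_upwards [ContinuousLinearMap.coeFn_holder (r := 1) (ContinuousLinearMap.mul ℂ ℂ)
    (hw.toLp w) G, hw.coeFn_toLp] with ξ hholder hwξ
  exact hholder.trans (by simp [hwξ])

lemma invFourierMul_toLp_schwartz (hw : MemLp w 2 volume) (φ : 𝓢(ℝ, ℂ)) :
    (invFourierMul (hw.toLp w) (φ.toLp 2) : ℝ → ℂ) = 𝓕⁻ fun ξ => w ξ * φ ξ := by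
  ext x
  rw [invFourierMul_toLp_apply]
  refine Real.fourierInv_congr_ae ?_ x
  filter_upwards [φ.coeFn_toLp 2] with ξ hξ
  rw [hξ]

lemma mulBounded_toLp_schwartz (hw : MemLp w ∞ volume) (hg : w.HasTemperateGrowth)
    (φ : 𝓢(ℝ, ℂ)) :
    mulBounded (hw.toLp w) (φ.toLp 2) = (SchwartzMap.smulLeftCLM ℂ w φ).toLp 2 := by
  refine Lp.ext ?_
  filter_upwards [ContinuousLinearMap.coeFn_holder (r := 2) (ContinuousLinearMap.mul ℂ ℂ)
    (hw.toLp w) (φ.toLp 2), hw.coeFn_toLp, φ.coeFn_toLp 2,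
    (SchwartzMap.smulLeftCLM ℂ w φ).coeFn_toLp 2] with ξ hholder hwξ hφξ hmulξ
  refine hholder.trans ?_
  rw [hmulξ, hwξ, hφξ]
  simp [hg]

lemma hasDerivAt_fourierInv {f : ℝ → ℂ} (hf : Integrable f)
    (hf' : Integrable fun ξ : ℝ => 2 * Real.pi * Complex.I * ξ * f ξ) (x : ℝ) :
    HasDerivAt (𝓕⁻ f) (𝓕⁻ (fun ξ : ℝ => 2 * Real.pi * Complex.I * ξ * f ξ) x) x := by
  have hmoment : Integrable fun ξ : ℝ => ξ • f ξ := by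
    refine (hf'.const_mul (2 * Real.pi * Complex.I)⁻¹).congr (.of_forall fun ξ => ?_)
    have : (2 * Real.pi * Complex.I : ℂ) ≠ 0 := by simp [Real.pi_ne_zero]
    simp only [Complex.real_smul]
    field_simp
  have hreflect : (𝓕⁻ f : ℝ → ℂ) = 𝓕 f ∘ Neg.neg := by
    ext y; exact Real.fourierInv_eq_fourier_neg f y
  rw [hreflect]
  refine ((Real.hasDerivAt_fourier hf hmoment (-x)).scomp x (hasDerivAt_neg x)).congr_deriv ?_
  rw [Real.fourierInv_eq_fourier_neg, Real.fourier_real_eq, Real.fourier_real_eq, ← integral_smul]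
  refine integral_congr_ae (.of_forall fun ξ => ?_)
  simp only [smul_eq_mul, neg_smul, one_smul, Circle.smul_def]
  ring

lemma hasDerivAt_invFourierMul (hw : MemLp w 2 volume) (hw' : MemLp w' 2 volume)
    (hmul : ∀ ξ : ℝ, w' ξ = 2 * Real.pi * Complex.I * ξ * w ξ) (G : L²) (x : ℝ) :
    HasDerivAt (invFourierMul (hw.toLp w) G) (invFourierMul (hw'.toLp w') G x) x := by
  have hinv : (invFourierMul (hw.toLp w) G : ℝ → ℂ) = 𝓕⁻ (fun ξ => w ξ * G ξ) :=
    funext fun y => invFourierMul_toLp_apply hw G y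
  have hsymbol : (fun ξ => w' ξ * G ξ) =
      fun ξ : ℝ => 2 * Real.pi * Complex.I * ξ * (w ξ * G ξ) := by
    ext ξ; rw [hmul, mul_assoc]
  rw [hinv, invFourierMul_toLp_apply, hsymbol]
  have hint : Integrable fun ξ => w ξ * G ξ := hw.integrable_mul (Lp.memLp G)
  have hint' : Integrable fun ξ => w' ξ * G ξ := hw'.integrable_mul (Lp.memLp G)
  exact hasDerivAt_fourierInv hint (hsymbol ▸ hint') x

lemma hasDerivAt_invFourierMul_schwartz (hw : MemLp w 2 volume) (hg : w'.HasTemperateGrowth)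
    (hmul : ∀ ξ : ℝ, w' ξ = 2 * Real.pi * Complex.I * ξ * w ξ) (φ : 𝓢(ℝ, ℂ)) (x : ℝ) :
    HasDerivAt (invFourierMul (hw.toLp w) (φ.toLp 2))
      ((𝓕⁻ (SchwartzMap.smulLeftCLM ℂ w' φ)) x) x := by
  have hcoe : (SchwartzMap.smulLeftCLM ℂ w' φ : ℝ → ℂ) =
      fun ξ : ℝ => 2 * Real.pi * Complex.I * ξ * (w ξ * φ ξ) := by
    ext ξ
    rw [SchwartzMap.smulLeftCLM_apply_apply hg, hmul, smul_eq_mul, mul_assoc]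
  have hint : Integrable fun ξ => w ξ * φ ξ := hw.integrable_mul (φ.memLp 2 volume)
  have hint' : Integrable fun ξ : ℝ => 2 * Real.pi * Complex.I * ξ * (w ξ * φ ξ) := by
    rw [← hcoe]; exact (SchwartzMap.smulLeftCLM ℂ w' φ).integrable
  rw [invFourierMul_toLp_schwartz, SchwartzMap.fourierInv_coe, hcoe]
  exact hasDerivAt_fourierInv hint hint' x

lemma invFourierMul_schwartz_sub_eq_integral (hw : MemLp w 2 volume) (hw' : MemLp w' ∞ volume)
    (hg : w'.HasTemperateGrowth) (hmul : ∀ ξ : ℝ, w' ξ = 2 * Real.pi * Complex.I * ξ * w ξ)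
    (φ : 𝓢(ℝ, ℂ)) (a b : ℝ) :
    invFourierMul (hw.toLp w) (φ.toLp 2) b - invFourierMul (hw.toLp w) (φ.toLp 2) a =
      ∫ x in a..b, (𝓕⁻ (mulBounded (hw'.toLp w') (φ.toLp 2)) : L²) x := by
  have hderiv := hasDerivAt_invFourierMul_schwartz hw hg hmul φ
  have hLp : (𝓕⁻ (mulBounded (hw'.toLp w') (φ.toLp 2)) : L²) =
      (𝓕⁻ (SchwartzMap.smulLeftCLM ℂ w' φ)).toLp 2 := by
    rw [mulBounded_toLp_schwartz hw' hg, SchwartzMap.toLp_fourierInv_eq]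
  rw [hLp, ← intervalIntegral.integral_eq_sub_of_hasDerivAt (fun x _ => hderiv x)
    ((𝓕⁻ (SchwartzMap.smulLeftCLM ℂ w' φ)).continuous.intervalIntegrable _ _)]
  refine intervalIntegral.integral_congr_ae ?_
  filter_upwards [(𝓕⁻ (SchwartzMap.smulLeftCLM ℂ w' φ)).coeFn_toLp 2] with x hx _
  rw [hx]

lemma invFourierMul_sub_eq_integral (hw : MemLp w 2 volume) (hw' : MemLp w' ∞ volume)
    (hg : w'.HasTemperateGrowth) (hmul : ∀ ξ : ℝ, w' ξ = 2 * Real.pi * Complex.I * ξ * w ξ)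
    (G : L²) (a b : ℝ) :
    invFourierMul (hw.toLp w) G b - invFourierMul (hw.toLp w) G a =
      ∫ x in a..b, (𝓕⁻ (mulBounded (hw'.toLp w') G) : L²) x := by
  wlog hab : a ≤ b generalizing a b
  · rw [intervalIntegral.integral_symm, ← this b a (le_of_not_ge hab), neg_sub]
  have hfin : volume (Ioc a b) ≠ ∞ := by simp
  have hinner : ∀ H : L², ∫ x in a..b, H x =
      inner ℂ (indicatorConstLp 2 measurableSet_Ioc hfin (1 : ℂ)) H := fun H => by
    rw [L2.inner_indicatorConstLp_one, intervalIntegral.integral_of_le hab]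
  refine DenseRange.induction_on (e := SchwartzMap.toLpCLM ℂ (E := ℝ) ℂ 2 volume)
    (SchwartzMap.denseRange_toLpCLM ENNReal.ofNat_ne_top) G (isClosed_eq ?_ ?_)
    fun φ => invFourierMul_schwartz_sub_eq_integral hw hw' hg hmul φ a b
  · exact ((continuous_eval_const b).comp (invFourierMul (hw.toLp w)).continuous).sub
      ((continuous_eval_const a).comp (invFourierMul (hw.toLp w)).continuous)
  · simp_rw [hinner]
    exact continuous_const.inner ((Lp.fourierTransformₗᵢ ℝ ℂ).symm.continuous.comp
      (mulBounded (hw'.toLp w')).continuous)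

lemma integral_fourierInv_schwartz_mul (φ : 𝓢(ℝ, ℂ)) {F : ℝ → ℂ} (hF : Integrable F) :
    ∫ ξ, (𝓕⁻ φ) ξ * F ξ = ∫ x, φ x * 𝓕⁻ F x := by
  have hswap := VectorFourier.integral_fourierIntegral_smul_eq_flip (L := -innerₗ ℝ)
    (μ := volume) (ν := volume) (e := Real.fourierChar) (f := φ) (g := F)
    Real.continuous_fourierChar
    (by simp only [LinearMap.neg_apply, innerₗ_apply_apply]; fun_prop) φ.integrable hF
  simpa [VectorFourier.fourierIntegral, SchwartzMap.fourierInv_coe, Real.fourierInv_eq,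
    mul_comm] using hswap

lemma eq_of_forall_integral_schwartz_eq {f g : ℝ → ℂ} (hf : Continuous f) (hg : Continuous g)
    (h : ∀ φ : 𝓢(ℝ, ℂ), ∫ x, φ x * f x = ∫ x, φ x * g x) : f = g := by
  refine (Continuous.ae_eq_iff_eq volume hf hg).1 ?_
  refine ae_eq_of_integral_contDiff_smul_eq hf.locallyIntegrable hg.locallyIntegrable
    fun φ hφ hφc => ?_
  have hsupp : HasCompactSupport (Complex.ofRealCLM ∘ φ) := hφc.comp_left rfl
  have hsmooth : ContDiff ℝ (⊤ : ℕ∞) (Complex.ofRealCLM ∘ φ) := by fun_prop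
  simpa using h (hsupp.toSchwartzMap hsmooth)

end FourierMultipliers

section BesselPotentials

open FourierTransform ENNReal
open scoped BoundedContinuousFunction

local notation "L²" => Lp ℂ 2 (volume : Measure ℝ)

variable {m : ℝ} {k : ℕ} {f : ℝ → ℝ} {g : L²}

lemma memLp_two_one_add_norm_sq_rpow {s : ℝ} (hs : 1 < 2 * s) :
    MemLp (fun ξ : ℝ => (1 + ‖ξ‖ ^ 2) ^ (-s / 2)) 2 volume := by
  have hcont : Continuous fun ξ : ℝ => (1 + ‖ξ‖ ^ 2) ^ (-s / 2) :=
    Continuous.rpow_const (by fun_prop) fun ξ => Or.inl (by positivity)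
  refine (memLp_two_iff_integrable_sq hcont.aestronglyMeasurable).2 ?_
  refine (integrable_rpow_neg_one_add_norm_sq (E := ℝ) (μ := volume) (r := 2 * s)
    (by simpa using hs)).congr (.of_forall fun ξ => ?_)
  simp only
  rw [← Real.rpow_mul_natCast (by positivity)]
  congr 1
  push_cast
  ring

/-- The symbol `(2πiξ)^k (1 + |ξ|²)^{-m/2}` of the `k`-th derivative of the Bessel potential of
order `-m`. -/
noncomputable def besselSymbol (m : ℝ) (k : ℕ) (ξ : ℝ) : ℂ :=
  (2 * Real.pi * Complex.I * ξ) ^ k * (((1 + ‖ξ‖ ^ 2) ^ (-m / 2) : ℝ) : ℂ)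

lemma besselSymbol_succ (m : ℝ) (k : ℕ) (ξ : ℝ) :
    besselSymbol m (k + 1) ξ = 2 * Real.pi * Complex.I * ξ * besselSymbol m k ξ := by
  simp only [besselSymbol, pow_succ]; ring

lemma besselSymbol_zero (m : ℝ) :
    besselSymbol m 0 = fun ξ : ℝ => (((1 + ‖ξ‖ ^ 2) ^ (-m / 2) : ℝ) : ℂ) := by
  ext ξ; simp [besselSymbol]

lemma hasTemperateGrowth_besselSymbol (m : ℝ) (k : ℕ) : (besselSymbol m k).HasTemperateGrowth := by
  unfold besselSymbol
  fun_prop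

lemma norm_pow_le_one_add_norm_sq_rpow (ξ : ℝ) (k : ℕ) :
    ‖ξ‖ ^ k ≤ (1 + ‖ξ‖ ^ 2) ^ ((k : ℝ) / 2) :=
  calc ‖ξ‖ ^ k ≤ √(1 + ‖ξ‖ ^ 2) ^ k := by gcongr; exact Real.le_sqrt_of_sq_le (by linarith)
    _ = (1 + ‖ξ‖ ^ 2) ^ ((k : ℝ) / 2) := by
      rw [Real.sqrt_eq_rpow, ← Real.rpow_mul_natCast (by positivity), one_div_mul_eq_div]

lemma norm_besselSymbol_le (m : ℝ) (k : ℕ) (ξ : ℝ) :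
    ‖besselSymbol m k ξ‖ ≤ (2 * Real.pi) ^ k * (1 + ‖ξ‖ ^ 2) ^ (-(m - k) / 2) := by
  have hnorm : ‖besselSymbol m k ξ‖ = (2 * Real.pi) ^ k * (‖ξ‖ ^ k * (1 + ‖ξ‖ ^ 2) ^ (-m / 2)) := by
    have hfreq : ‖(2 * Real.pi * Complex.I * ξ : ℂ)‖ = 2 * Real.pi * ‖ξ‖ := by
      simp [abs_of_pos Real.pi_pos]
    rw [besselSymbol, norm_mul, norm_pow, hfreq, Complex.norm_of_nonneg (by positivity), mul_pow,
      mul_assoc]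
  have hsplit : (1 + ‖ξ‖ ^ 2) ^ (-(m - k) / 2) =
      (1 + ‖ξ‖ ^ 2) ^ ((k : ℝ) / 2) * (1 + ‖ξ‖ ^ 2) ^ (-m / 2) := by
    rw [← Real.rpow_add (by positivity)]; congr 1; ring
  rw [hnorm, hsplit]
  gcongr
  exact norm_pow_le_one_add_norm_sq_rpow ξ k

lemma memLp_two_besselSymbol (h : 1 < 2 * (m - k)) : MemLp (besselSymbol m k) 2 volume := by
  refine (memLp_two_one_add_norm_sq_rpow h).of_le_mul (c := (2 * Real.pi) ^ k)
    (hasTemperateGrowth_besselSymbol m k).1.continuous.aestronglyMeasurable (.of_forall fun ξ => ?_)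
  rw [Real.norm_of_nonneg (by positivity)]
  exact norm_besselSymbol_le m k ξ

lemma memLp_top_besselSymbol (h : (k : ℝ) ≤ m) : MemLp (besselSymbol m k) ∞ volume := by
  refine memLp_top_of_bound
    (hasTemperateGrowth_besselSymbol m k).1.continuous.aestronglyMeasurable ((2 * Real.pi) ^ k)
    (.of_forall fun ξ => (norm_besselSymbol_le m k ξ).trans ?_)
  refine mul_le_of_le_one_right (by positivity) ?_
  exact Real.rpow_le_one_of_one_le_of_nonpos (by simp [sq_nonneg]) (by linarith)

/-- The map sending the Bessel potential of order `m` of a function to the `k`-th derivative of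
that function, which is a bounded continuous function when `m - k > 1/2`. -/
noncomputable def besselDeriv (hk : MemLp (besselSymbol m k) 2 volume) : L² →L[ℝ] (ℝ →ᵇ ℂ) :=
  (invFourierMul (hk.toLp _) ∘L
    (Lp.fourierTransformₗᵢ ℝ ℂ).toContinuousLinearEquiv.toContinuousLinearMap).restrictScalars ℝ

lemma besselDeriv_apply (hk : MemLp (besselSymbol m k) 2 volume) (g : L²) :
    besselDeriv hk g = invFourierMul (hk.toLp _) (𝓕 g) := rfl

lemma hasDerivAt_re_besselDeriv (hk : MemLp (besselSymbol m k) 2 volume)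
    (hk' : MemLp (besselSymbol m (k + 1)) 2 volume) (g : L²) (x : ℝ) :
    HasDerivAt (fun y => (besselDeriv hk g y).re) (besselDeriv hk' g x).re x :=
  Complex.reCLM.hasFDerivAt.comp_hasDerivAt x
    (hasDerivAt_invFourierMul hk hk' (besselSymbol_succ m k) (𝓕 g) x)

lemma abs_re_besselDeriv_le (hk : MemLp (besselSymbol m k) 2 volume) (g : L²) (x : ℝ) :
    |(besselDeriv hk g x).re| ≤ ‖besselDeriv hk‖ * ‖g‖ :=
  (Complex.abs_re_le_norm _).trans <|
    ((besselDeriv hk g).norm_coe_le_norm x).trans ((besselDeriv hk).le_opNorm g)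

lemma continuousOn_re_besselDeriv (hk : MemLp (besselSymbol m k) 2 volume) {c : ℝ → L²}
    {s : Set ℝ} (hc : ContinuousOn c s) :
    ContinuousOn (Function.uncurry fun t x => (besselDeriv hk (c t) x).re) (s ×ˢ univ) := by
  refine Complex.continuous_re.comp_continuousOn ?_
  exact ((besselDeriv hk).continuous.comp_continuousOn
    (hc.comp continuousOn_fst fun p hp => hp.1)).eval continuousOn_snd

lemma hasDerivAt_re_besselDeriv_time (hk : MemLp (besselSymbol m k) 2 volume) {c : ℝ → L²}
    {c' : L²} {t : ℝ} (hc : HasDerivAt c c' t) (x : ℝ) :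
    HasDerivAt (fun s => (besselDeriv hk (c s) x).re) (besselDeriv hk c' x).re t :=
  ((Complex.reCLM ∘L BoundedContinuousFunction.evalCLM ℝ x) ∘L
    besselDeriv hk).hasFDerivAt.comp_hasDerivAt t hc

lemma absolutelyContinuousOnInterval_re_besselDeriv (hk : MemLp (besselSymbol m k) 2 volume)
    (hk' : MemLp (besselSymbol m (k + 1)) ∞ volume) (g : L²) (a b : ℝ) :
    AbsolutelyContinuousOnInterval (fun x => (besselDeriv hk g x).re) a b := by
  set H : L² := 𝓕⁻ (mulBounded (hk'.toLp _) (𝓕 g)) with hH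
  have hHint : ∀ c d, IntervalIntegrable H volume c d := fun c d =>
    (((Lp.memLp H).locallyIntegrable (by norm_num)).integrableOn_isCompact
      isCompact_uIcc).intervalIntegrable
  have hprimitive : (fun x => (besselDeriv hk g x).re) =
      fun x => (besselDeriv hk g a).re + ∫ y in a..x, (H y).re := funext fun x => by
    have hsub := invFourierMul_sub_eq_integral hk hk' (hasTemperateGrowth_besselSymbol m (k + 1))
      (besselSymbol_succ m k) (𝓕 g) a x
    have hre : ∫ y in a..x, (H y).re = (∫ y in a..x, H y).re :=
      Complex.reCLM.intervalIntegral_comp_comm (hHint a x)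
    rw [hre, hH, ← hsub, ← besselDeriv_apply, Complex.sub_re, add_sub_cancel]
  have hHre : IntervalIntegrable (fun y => (H y).re) volume a b :=
    ⟨(hHint a b).1.re, (hHint a b).2.re⟩
  rw [hprimitive]
  exact contDiffOn_const.absolutelyContinuousOnInterval.add
    (hHre.absolutelyContinuousOnInterval_intervalIntegral left_mem_uIcc)

lemma HasBesselLift.ofReal_eq_invFourierMul (h : HasBesselLift m f g)
    (hk : MemLp (besselSymbol m 0) 2 volume) (x : ℝ) :
    (f x : ℂ) = invFourierMul (hk.toLp _) (𝓕 g) x := by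
  obtain ⟨hfc, hf, hlift⟩ := h
  have hinv := (TemperedDistribution.besselPotential_neg_apply_eq_iff m _ _).2 hlift
  have hint : Integrable fun ξ => besselSymbol m 0 ξ * (𝓕 g : L²) ξ :=
    hk.integrable_mul (Lp.memLp _)
  refine congrFun (eq_of_forall_integral_schwartz_eq (f := fun x => (f x : ℂ))
    (by fun_prop) (invFourierMul (hk.toLp _) (𝓕 g)).continuous fun φ => ?_) x
  have hpair := congrArg (fun S : 𝓢'(ℝ, ℂ) => S φ) hinv
  simp only [TemperedDistribution.besselPotential,
    TemperedDistribution.fourierMultiplierCLM_apply_apply] at hpair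
  rw [← TemperedDistribution.fourier_apply, Lp.fourier_toTemperedDistribution_eq,
    Lp.toTemperedDistribution_apply, Lp.toTemperedDistribution_apply, ← besselSymbol_zero]
    at hpair
  calc ∫ x, φ x * (f x : ℂ)
      = ∫ x, φ x • (hf.toLp _ : L²) x := by
        refine integral_congr_ae ?_
        filter_upwards [hf.coeFn_toLp] with x hx
        rw [hx, smul_eq_mul]
    _ = ∫ ξ, (𝓕⁻ φ) ξ * (besselSymbol m 0 ξ * (𝓕 g : L²) ξ) := by
        rw [← hpair]
        refine integral_congr_ae (.of_forall fun ξ => ?_)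
        simp only
        rw [SchwartzMap.smulLeftCLM_apply_apply (hasTemperateGrowth_besselSymbol m 0)]
        simp only [smul_eq_mul]
        ring
    _ = ∫ x, φ x * 𝓕⁻ (fun ξ => besselSymbol m 0 ξ * (𝓕 g : L²) ξ) x :=
        integral_fourierInv_schwartz_mul φ hint
    _ = ∫ x, φ x * invFourierMul (hk.toLp _) (𝓕 g) x := by
        simp_rw [invFourierMul_toLp_apply]

lemma HasBesselLift.eq_re_besselDeriv (h : HasBesselLift m f g)
    (hk : MemLp (besselSymbol m 0) 2 volume) : f = fun x => (besselDeriv hk g x).re := by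
  ext x
  rw [besselDeriv_apply, ← h.ofReal_eq_invFourierMul hk x, Complex.ofReal_re]

lemma HasBesselLift.memLp (h : HasBesselLift m f g) : MemLp f 2 volume := by
  obtain ⟨-, hf, -⟩ := h
  exact hf.re

lemma HasBesselLift.absolutelyContinuousOnInterval_deriv (h : HasBesselLift m f g) (hm : 2 ≤ m)
    (a b : ℝ) : AbsolutelyContinuousOnInterval (deriv f) a b := by
  have h0 : MemLp (besselSymbol m 0) 2 volume := memLp_two_besselSymbol (by norm_num; linarith)
  have h1 : MemLp (besselSymbol m 1) 2 volume := memLp_two_besselSymbol (by norm_num; linarith)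
  have hderiv : deriv f = fun x => (besselDeriv h1 g x).re := by
    rw [h.eq_re_besselDeriv h0]
    exact funext fun x => (hasDerivAt_re_besselDeriv h0 h1 g x).deriv
  rw [hderiv]
  exact absolutelyContinuousOnInterval_re_besselDeriv h1
    (memLp_top_besselSymbol (by exact_mod_cast hm)) g a b

end BesselPotentials

section ExtendTime

variable {T : ℝ}

/-- The extension of a function of `(t, x)`, `t ∈ [0, T]`, to all times that is constant in time
outside `[0, T]`. -/
noncomputable def extendTime (hT : 0 ≤ T) (f : ℝ → ℝ → ℝ) : ℝ → ℝ → ℝ :=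
  fun t => f (projIcc 0 T hT t)

lemma extendTime_of_mem (hT : 0 ≤ T) (f : ℝ → ℝ → ℝ) {t : ℝ} (ht : t ∈ Icc 0 T) :
    extendTime hT f t = f t := by
  rw [extendTime, projIcc_of_mem hT ht]

lemma extendTime_mul (hT : 0 ≤ T) (f g : ℝ → ℝ → ℝ) :
    extendTime hT (f * g) = extendTime hT f * extendTime hT g := rfl

lemma extendTime_eventuallyEq (hT : 0 ≤ T) (f : ℝ → ℝ → ℝ) {t : ℝ} (ht : t ∈ Ioo 0 T) (x : ℝ) :
    (fun s => extendTime hT f s x) =ᶠ[𝓝 t] fun s => f s x :=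
  mem_of_superset (Icc_mem_nhds ht.1 ht.2) fun _ hs => congrFun (extendTime_of_mem hT f hs) x

lemma spaceDeriv_extendTime (hT : 0 ≤ T) (f : ℝ → ℝ → ℝ) {t : ℝ} (ht : t ∈ Icc 0 T) (x : ℝ) :
    ∂ₓ (extendTime hT f) t x = ∂ₓ f t x := by
  simp only [spaceDeriv, extendTime_of_mem hT f ht]

lemma timeDeriv_extendTime (hT : 0 ≤ T) (f : ℝ → ℝ → ℝ) {t : ℝ} (ht : t ∈ Ioo 0 T) (x : ℝ) :
    ∂ₜ (extendTime hT f) t x = ∂ₜ f t x :=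
  (extendTime_eventuallyEq hT f ht x).deriv_eq

end ExtendTime

namespace IsC1Sobolev

variable {m T : ℝ} {f : ℝ → ℝ → ℝ}

lemma exists_continuous_hasBesselLift_extendTime (hf : IsC1Sobolev m T f) (hT : 0 ≤ T) :
    ∃ G : ℝ → Lp ℂ 2 (volume : Measure ℝ), Continuous G ∧ ContDiffOn ℝ 1 G (Ioo 0 T) ∧
      (∃ C, ∀ t, ‖G t‖ ≤ C) ∧ ∀ t, HasBesselLift m (extendTime hT f t) (G t) := by
  obtain ⟨g, hg, hlift⟩ := hf
  refine ⟨fun t => g (projIcc 0 T hT t),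
    hg.continuousOn.comp_continuous (continuous_subtype_val.comp continuous_projIcc)
      fun t => (projIcc 0 T hT t).2,
    (hg.mono Ioo_subset_Icc_self).congr fun t ht => by
      rw [projIcc_of_mem hT (Ioo_subset_Icc_self ht)],
    ?_, fun t => hlift _ (projIcc 0 T hT t).2⟩
  obtain ⟨C, hC⟩ := isCompact_Icc.exists_bound_of_continuousOn hg.continuousOn
  exact ⟨C, fun t => hC _ (projIcc 0 T hT t).2⟩

lemma isC1Field_extendTime (hf : IsC1Sobolev m T f) (hm : 3 / 2 < m) (hT : 0 ≤ T) :
    IsC1Field T (extendTime hT f) := by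
  obtain ⟨G, hGc, hG, -, hlift⟩ := hf.exists_continuous_hasBesselLift_extendTime hT
  have h0 : MemLp (besselSymbol m 0) 2 volume := memLp_two_besselSymbol (by norm_num; linarith)
  have h1 : MemLp (besselSymbol m 1) 2 volume := memLp_two_besselSymbol (by norm_num; linarith)
  have hval : extendTime hT f = fun t x => (besselDeriv h0 (G t) x).re :=
    funext fun t => (hlift t).eq_re_besselDeriv h0
  have hG' : ContinuousOn (deriv G) (Ioo 0 T) := hG.continuousOn_deriv_of_isOpen isOpen_Ioo le_rfl
  rw [hval]
  exact .of_hasDerivAt (fun t x => hasDerivAt_re_besselDeriv h0 h1 (G t) x)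
    (fun t ht x => hasDerivAt_re_besselDeriv_time h0
      ((hG.differentiableOn one_ne_zero).differentiableAt (Ioo_mem_nhds ht.1 ht.2)).hasDerivAt x)
    (by simpa using continuousOn_re_besselDeriv h0 (s := univ) hGc.continuousOn)
    (by simpa using continuousOn_re_besselDeriv h1 (s := univ) hGc.continuousOn)
    (continuousOn_re_besselDeriv h0 hG')

lemma exists_abs_extendTime_le (hf : IsC1Sobolev m T f) (hm : 1 / 2 < m) (hT : 0 ≤ T) :
    ∃ C, ∀ t x, |extendTime hT f t x| ≤ C := by
  obtain ⟨G, -, -, ⟨C, hC⟩, hlift⟩ := hf.exists_continuous_hasBesselLift_extendTime hT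
  have h0 : MemLp (besselSymbol m 0) 2 volume := memLp_two_besselSymbol (by norm_num; linarith)
  refine ⟨‖besselDeriv h0‖ * C, fun t x => ?_⟩
  rw [(hlift t).eq_re_besselDeriv h0]
  exact (abs_re_besselDeriv_le h0 (G t) x).trans (by gcongr; exact hC t)

lemma exists_lipschitzWith_extendTime (hf : IsC1Sobolev m T f) (hm : 3 / 2 < m) (hT : 0 ≤ T) :
    ∃ K : NNReal, ∀ t, LipschitzWith K (extendTime hT f t) := by
  obtain ⟨G, -, -, ⟨C, hC⟩, hlift⟩ := hf.exists_continuous_hasBesselLift_extendTime hT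
  have h0 : MemLp (besselSymbol m 0) 2 volume := memLp_two_besselSymbol (by norm_num; linarith)
  have h1 : MemLp (besselSymbol m 1) 2 volume := memLp_two_besselSymbol (by norm_num; linarith)
  refine ⟨(‖besselDeriv h1‖ * C).toNNReal, fun t => ?_⟩
  rw [(hlift t).eq_re_besselDeriv h0]
  have hderiv := hasDerivAt_re_besselDeriv h0 h1 (G t)
  refine lipschitzWith_of_nnnorm_deriv_le (fun x => (hderiv x).differentiableAt) fun x => ?_
  rw [(hderiv x).deriv]
  refine NNReal.coe_le_coe.1 (le_trans ?_ (Real.le_coe_toNNReal _))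
  exact (abs_re_besselDeriv_le h1 (G t) x).trans (by gcongr; exact hC t)

lemma memLp_extendTime (hf : IsC1Sobolev m T f) (hT : 0 ≤ T) (t : ℝ) :
    MemLp (extendTime hT f t) 2 volume := by
  obtain ⟨G, -, -, -, hlift⟩ := hf.exists_continuous_hasBesselLift_extendTime hT
  exact (hlift t).memLp

lemma absolutelyContinuousOnInterval_spaceDeriv_extendTime (hf : IsC1Sobolev m T f) (hm : 2 ≤ m)
    (hT : 0 ≤ T) (t a b : ℝ) :
    AbsolutelyContinuousOnInterval (∂ₓ (extendTime hT f) t) a b := by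
  obtain ⟨G, -, -, -, hlift⟩ := hf.exists_continuous_hasBesselLift_extendTime hT
  exact (hlift t).absolutelyContinuousOnInterval_deriv hm a b

end IsC1Sobolev

section SobolevSolutions

lemma eq_zero_of_ae_eq_zero {f : ℝ → ℝ} (hf : Continuous f) (h : ∀ᵐ x, f x = 0) (x : ℝ) :
    f x = 0 :=
  congrFun ((Continuous.ae_eq_iff_eq volume hf continuous_const).1 h) x

lemma IsC1Field.absolutelyContinuousOnInterval_slice {T : ℝ} {f : ℝ → ℝ → ℝ}
    (hf : IsC1Field T f) (t a b : ℝ) : AbsolutelyContinuousOnInterval (f t) a b :=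
  (contDiff_one_iff_deriv.2
    ⟨hf.differentiable_space t, hf.continuous_spaceDeriv_slice t⟩).contDiffOn
      |>.absolutelyContinuousOnInterval

lemma momentumFlux_eq_mul (ν γ : ℝ) (ρ u q : ℝ → ℝ → ℝ) (t : ℝ) :
    momentumFlux ν γ ρ u q t =
      fun x => ν * ∂ₓ u t x - (ρ * u * u) t x - (γ - 1) * q t x := by
  ext x
  simp only [momentumFlux, Pi.mul_apply]
  ring

namespace IsSolution

variable {μ lam γ m T : ℝ} {ρ₀ u₀ e₀ : ℝ → ℝ} {ρ u e : ℝ → ℝ → ℝ} {t : ℝ}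

lemma mass_extendTime (h : IsSolution μ lam γ m T ρ₀ u₀ e₀ ρ u e) (hm : 3 / 2 < m) (hT : 0 ≤ T)
    (ht : t ∈ Ioo 0 T) (x : ℝ) :
    ∂ₜ (extendTime hT ρ) t x + ∂ₓ (extendTime hT ρ * extendTime hT u) t x = 0 := by
  have hρ := h.regular_density.isC1Field_extendTime hm hT
  have hu := h.regular_velocity.isC1Field_extendTime hm hT
  refine eq_zero_of_ae_eq_zero ((hρ.continuous_timeDeriv_slice ht).add
    ((hρ.mul hu).continuous_spaceDeriv_slice t)) ?_ x
  filter_upwards [h.mass t ht] with x hx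
  rw [← extendTime_mul, Pi.add_apply, timeDeriv_extendTime hT ρ ht,
    spaceDeriv_extendTime hT _ (Ioo_subset_Icc_self ht)]
  exact hx

lemma energy_extendTime (h : IsSolution μ lam γ m T ρ₀ u₀ e₀ ρ u e) (hm : 3 / 2 < m) (hT : 0 ≤ T)
    (ht : t ∈ Ioo 0 T) (x : ℝ) :
    ∂ₜ (extendTime hT (ρ * e)) t x + ∂ₓ (extendTime hT (ρ * e) * extendTime hT u) t x
        + (γ - 1) * extendTime hT (ρ * e) t x * ∂ₓ (extendTime hT u) t x
      = (2 * μ + lam) * ∂ₓ (extendTime hT u) t x ^ 2 := by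
  have hu := h.regular_velocity.isC1Field_extendTime hm hT
  have hq : IsC1Field T (extendTime hT (ρ * e)) :=
    (h.regular_density.isC1Field_extendTime hm hT).mul
      (h.regular_energy.isC1Field_extendTime hm hT)
  have hux := hu.continuous_spaceDeriv_slice t
  refine sub_eq_zero.1 (eq_zero_of_ae_eq_zero
    ((((hq.continuous_timeDeriv_slice ht).add ((hq.mul hu).continuous_spaceDeriv_slice t)).add
      ((continuous_const.mul (hq.continuous_slice t)).mul hux)).sub
      (continuous_const.mul (hux.pow 2))) ?_ x)
  have htT := Ioo_subset_Icc_self ht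
  filter_upwards [h.energy t ht] with x hx
  simp only [← extendTime_mul, Pi.sub_apply, Pi.add_apply, Pi.mul_apply, Pi.pow_apply]
  rw [timeDeriv_extendTime hT _ ht, spaceDeriv_extendTime hT _ htT,
    spaceDeriv_extendTime hT _ htT, extendTime_of_mem hT _ htT]
  change ∂ₜ (ρ * e) t x + ∂ₓ (ρ * e * u) t x + pressure γ ρ e t x * ∂ₓ u t x =
    μ / 2 * (∂ₓ u t x + ∂ₓ u t x) ^ 2 + lam * ∂ₓ u t x ^ 2 at hx
  simp only [pressure] at hx
  simp only [Pi.mul_apply]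
  linarith

lemma ae_timeDeriv_eq_deriv_momentumFlux (h : IsSolution μ lam γ m T ρ₀ u₀ e₀ ρ u e)
    (hm : 2 ≤ m) (hT : 0 ≤ T) (ht : t ∈ Ioo 0 T) (a b : ℝ) :
    ∀ᵐ x, x ∈ uIcc a b → ∂ₜ (extendTime hT ρ * extendTime hT u) t x =
      deriv (momentumFlux (2 * μ + lam) γ (extendTime hT ρ) (extendTime hT u)
        (extendTime hT (ρ * e)) t) x := by
  have hρ := h.regular_density.isC1Field_extendTime (by linarith) hT
  have hu := h.regular_velocity.isC1Field_extendTime (by linarith) hT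
  have hq : IsC1Field T (extendTime hT (ρ * e)) :=
    hρ.mul (h.regular_energy.isC1Field_extendTime (by linarith) hT)
  have hux := h.regular_velocity.absolutelyContinuousOnInterval_spaceDeriv_extendTime hm hT t a b
  have htT := Ioo_subset_Icc_self ht
  have huxx : deriv (∂ₓ (extendTime hT u) t) = deriv (deriv (u t)) :=
    congrArg deriv (funext fun y => spaceDeriv_extendTime hT u htT y)
  have hpressure : ∀ x, deriv (fun y => pressure γ ρ e t y) x = (γ - 1) * ∂ₓ (ρ * e) t x :=
    fun x => by
      simp only [pressure, mul_assoc]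
      exact deriv_const_mul_field _
  filter_upwards [h.momentum t ht, hux.ae_differentiableAt] with x hx huxx_diff hxab
  have hflux := (((huxx_diff hxab).hasDerivAt.const_mul (2 * μ + lam)).sub
    (((hρ.mul hu).mul hu).hasDerivAt_space t x)).sub
      ((hq.hasDerivAt_space t x).const_mul (γ - 1))
  rw [momentumFlux_eq_mul]
  refine Eq.trans ?_ hflux.deriv.symm
  rw [huxx, ← extendTime_mul, ← extendTime_mul, timeDeriv_extendTime hT _ ht,
    spaceDeriv_extendTime hT _ htT, spaceDeriv_extendTime hT _ htT]
  rw [hpressure] at hx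
  change ∂ₜ (ρ * u) t x + ∂ₓ (ρ * u * u) t x + _ = _ at hx
  linarith

lemma momentum_extendTime (h : IsSolution μ lam γ m T ρ₀ u₀ e₀ ρ u e) (hm : 2 ≤ m) (hT : 0 ≤ T)
    (ht : t ∈ Ioo 0 T) (a b : ℝ) :
    ∫ x in a..b, ∂ₜ (extendTime hT ρ * extendTime hT u) t x =
      momentumFlux (2 * μ + lam) γ (extendTime hT ρ) (extendTime hT u)
          (extendTime hT (ρ * e)) t b -
        momentumFlux (2 * μ + lam) γ (extendTime hT ρ) (extendTime hT u)
          (extendTime hT (ρ * e)) t a := by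
  have hρ := h.regular_density.isC1Field_extendTime (by linarith) hT
  have hu := h.regular_velocity.isC1Field_extendTime (by linarith) hT
  have hq : IsC1Field T (extendTime hT (ρ * e)) :=
    hρ.mul (h.regular_energy.isC1Field_extendTime (by linarith) hT)
  have hflux : AbsolutelyContinuousOnInterval (momentumFlux (2 * μ + lam) γ (extendTime hT ρ)
      (extendTime hT u) (extendTime hT (ρ * e)) t) a b := by
    rw [momentumFlux_eq_mul]
    exact (((h.regular_velocity.absolutelyContinuousOnInterval_spaceDeriv_extendTime hm hT t a
      b).const_mul _).sub (((hρ.mul hu).mul hu).absolutelyContinuousOnInterval_slice t a b)).sub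
        ((hq.absolutelyContinuousOnInterval_slice t a b).const_mul _)
  rw [← hflux.integral_deriv_eq_sub]
  refine intervalIntegral.integral_congr_ae ?_
  filter_upwards [h.ae_timeDeriv_eq_deriv_momentumFlux hm hT ht a b] with x hx hxab
  exact hx (uIoc_subset_uIcc hxab)

theorem isClassicalSolution_extendTime (h : IsSolution μ lam γ m T ρ₀ u₀ e₀ ρ u e) (hm : 2 ≤ m)
    (hT : 0 ≤ T) :
    IsClassicalSolution (2 * μ + lam) γ T (extendTime hT ρ) (extendTime hT u)
      (extendTime hT (ρ * e)) where
  density := h.regular_density.isC1Field_extendTime (by linarith) hT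
  velocity := h.regular_velocity.isC1Field_extendTime (by linarith) hT
  internalEnergy := (h.regular_density.isC1Field_extendTime (by linarith) hT).mul
    (h.regular_energy.isC1Field_extendTime (by linarith) hT)
  bounded := by
    obtain ⟨Cρ, hCρ⟩ := h.regular_density.exists_abs_extendTime_le (by linarith) hT
    obtain ⟨Cu, hCu⟩ := h.regular_velocity.exists_abs_extendTime_le (by linarith) hT
    exact ⟨max Cρ Cu, fun t x => ⟨le_max_of_le_left (hCρ t x), le_max_of_le_right (hCu t x)⟩⟩
  lipschitz := h.regular_velocity.exists_lipschitzWith_extendTime (by linarith) hT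
  memLp := h.regular_velocity.memLp_extendTime hT
  vacuum t x hx := by
    rw [extendTime_mul, Pi.mul_apply, Pi.mul_apply, hx, zero_mul]
  mass _ ht := h.mass_extendTime (by linarith) hT ht
  momentum _ ht := h.momentum_extendTime hm hT ht
  energy _ ht := h.energy_extendTime (by linarith) hT ht

end IsSolution

end SobolevSolutions

section InitialData

variable {ρ₀ u₀ e₀ : ℝ → ℝ}

lemma eq_zero_of_notMem_interior_tsupport {f : ℝ → ℝ} (hf : Continuous f) {x : ℝ}
    (hx : x ∉ interior (tsupport f)) : f x = 0 := by
  have hcompl : (tsupport f)ᶜ ⊆ {y | f y = 0} := fun y => image_eq_zero_of_notMem_tsupport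
  refine closure_minimal hcompl (isClosed_eq hf continuous_const) ?_
  rwa [closure_compl]

lemma LeftCondition.hasLeftOutflow (h : LeftCondition ρ₀ u₀ e₀) (hρ₀ : Continuous ρ₀)
    (hsupp : tsupport ρ₀ = Icc 0 1) (hpos : ∀ x ∈ Ioo (0 : ℝ) 1, 0 < ρ₀ x)
    (he₀ : ∀ x ∈ Ioo (0 : ℝ) 1, 0 ≤ e₀ x) : HasLeftOutflow ρ₀ u₀ e₀ := by
  obtain ⟨-, l, -, hl0, hl1, -, hul, hu⟩ := h
  refine ⟨0, l, 1, ⟨hl0, hl1⟩, fun x hx => eq_zero_of_notMem_interior_tsupport hρ₀ ?_,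
    fun x hx => ⟨hpos x hx, he₀ x hx⟩, hul, hu⟩
  rw [hsupp, interior_Icc]
  exact fun hx' => hx'.1.not_ge hx

lemma RightCondition.hasRightOutflow (h : RightCondition ρ₀ u₀ e₀) (hρ₀ : Continuous ρ₀)
    (hsupp : tsupport ρ₀ = Icc 0 1) (hpos : ∀ x ∈ Ioo (0 : ℝ) 1, 0 < ρ₀ x)
    (he₀ : ∀ x ∈ Ioo (0 : ℝ) 1, 0 ≤ e₀ x) : HasRightOutflow ρ₀ u₀ e₀ := by
  obtain ⟨-, l, -, hl0, hl1, -, hul, hu⟩ := h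
  refine ⟨0, l, 1, ⟨hl0, hl1⟩, fun x hx => eq_zero_of_notMem_interior_tsupport hρ₀ ?_,
    fun x hx => ⟨hpos x hx, he₀ x hx⟩, hul, hu⟩
  rw [hsupp, interior_Icc]
  exact fun hx' => hx'.2.not_ge hx

end InitialData

end FullNS

theorem theorem1p2_general {μ lam γ m T : ℝ} (hlam : 0 < 2 * μ + lam) (hγ : 1 ≤ γ) (hm : 2 ≤ m)
    (hT : 0 < T) {ρ₀ u₀ e₀ : ℝ → ℝ}
    (hdata : FullNS.HasLeftOutflow ρ₀ u₀ e₀ ∨ FullNS.HasRightOutflow ρ₀ u₀ e₀) :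
    ¬ ∃ ρ u e : ℝ → ℝ → ℝ, FullNS.IsSolution μ lam γ m T ρ₀ u₀ e₀ ρ u e := by
  rintro ⟨ρ, u, e, h⟩
  have hclassical := h.isClassicalSolution_extendTime hm hT.le
  have hinit : ∀ f : ℝ → ℝ → ℝ, FullNS.extendTime hT.le f 0 = f 0 := fun f =>
    FullNS.extendTime_of_mem hT.le f ⟨le_rfl, hT.le⟩
  have hρ : FullNS.extendTime hT.le ρ 0 = ρ₀ := (hinit ρ).trans (funext h.initial_density)
  have hu : FullNS.extendTime hT.le u 0 = u₀ := (hinit u).trans (funext h.initial_velocity)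
  have hq : FullNS.extendTime hT.le (ρ * e) 0 = ρ₀ * e₀ :=
    (hinit (ρ * e)).trans <|
      congrArg₂ (· * ·) (funext h.initial_density) (funext h.initial_energy)
  rcases hdata with hleft | hright
  · refine hclassical.not_hasLeftOutflow hlam hγ hT ?_
    rw [hρ, hu, hq]
    exact hleft.mul_energy
  · refine hclassical.not_hasRightOutflow hlam hγ hT ?_
    rw [hρ, hu, hq]
    exact hright.mul_energy

theorem theorem1p2 (μ lam γ : ℝ) (hμ : 0 < μ) (hlam : 0 < 2 * μ + lam) (hγ : 1 < γ)
    (ρ₀ u₀ e₀ : ℝ → ℝ)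
    (hρ₀c : Continuous ρ₀) (hu₀c : Continuous u₀) (he₀c : Continuous e₀)
    (hsupp : tsupport ρ₀ = Set.Icc 0 1) (hpos : ∀ x ∈ Set.Ioo (0 : ℝ) 1, 0 < ρ₀ x)
    (he₀ : ∀ x ∈ Set.Ioo (0 : ℝ) 1, 0 ≤ e₀ x) (he₀' : ∃ x ∈ Set.Ioo (0 : ℝ) 1, e₀ x ≠ 0)
    (hdata : FullNS.LeftCondition ρ₀ u₀ e₀ ∨ FullNS.RightCondition ρ₀ u₀ e₀)
    (m : ℝ) (hm : 2 < m) (T : ℝ) (hT : 0 < T) :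
    ¬ ∃ ρ u e : ℝ → ℝ → ℝ, FullNS.IsSolution μ lam γ m T ρ₀ u₀ e₀ ρ u e :=
  theorem1p2_general hlam hγ.le hm.le hT <|
    hdata.imp (·.hasLeftOutflow hρ₀c hsupp hpos he₀) (·.hasRightOutflow hρ₀c hsupp hpos he₀)
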